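/- Let $h(t)=t\log_2\frac1t+(1-t)\log_2\frac1{1-t}$ be the binary entropy function and, for an integer $k\ge 2$ and $0<\gamma<\frac12$, let $$F(k,\gamma)=\min_{0<\alpha<1}\Big(\log_2\frac{(1+\alpha)^k+(1-\alpha)^k}{2}-k\gamma\log_2\alpha\Big).$$ For every $\varepsilon>0$ there are constants $c_\varepsilon,C_\varepsilon,A_\varepsilon>0$, depending only on $\varepsilon$, such that the following holds. Let $0<\gamma<\frac12$ and $0<\lambda<h(\gamma)$ satisfy $\varepsilon=\min\{\lambda,h(\gamma)-\lambda\}$. For a positive integer $n$ such that $\lambda n$ is an integer and $\gamma n$ is an even integer, let $M$ be a uniformly random $\lambda n\times n$ matrix over $\mathbb F_2$, let $C=\{x\in\mathbb F_2^n: Mx=0\}$ be the random linear code with parity check matrix $M$, and let $X$ be the number of words of Hamming weight $\gamma n$ in $C$. Then, as $n\to\infty$ through such integers, uniformly over all integers $k$ with $C_\varepsilon\le k\le c_\varepsilon n$, $$\frac{\mathbb E\,(X-\mathbb EX)^k}{\mathrm{Var}(X)^{k/2}}\;\approx\;2^{\left(F(k,\gamma)-\frac k2h(\gamma)-\left(\frac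 k2-1\right)\lambda\right)n},$$ where $\approx$ means equality up to lower order terms in the exponent, in the following precise sense: for every $\delta>0$ there is $n_0$ (depending on $\gamma,\lambda,\delta$) such that for all such $n\ge n_0$ and all integers $k$ with $C_\varepsilon\le k\le c_\varepsilon n$, the left-hand side is between $$2^{\left(F(k,\gamma)-\frac k2h(\gamma)-\left(\frac k2-1\right)\lambda\right)n\,-\,(\delta n+A_\varepsilon k\log_2 n)}\quad\text{and}\quad 2^{\left(F(k,\gamma)-\frac k2h(\gamma)-\left(\frac k2-1\right)\lambda\right)n\,+\,(\delta n+A_\varepsilon k\log_2 n)}.$$ -/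

import Mathlib

open scoped BigOperators

noncomputable section

/-- The binary entropy function `h(t) = t log₂ (1/t) + (1 - t) log₂ (1/(1 - t))`. -/
def binaryEntropy (t : ℝ) : ℝ :=
  t * Real.logb 2 (1 / t) + (1 - t) * Real.logb 2 (1 / (1 - t))

/-- The exponent
`F(k, γ) = min_{0 < α < 1} ( log₂ (((1 + α) ^ k + (1 - α) ^ k) / 2) - k γ log₂ α )`.
For `k ≥ 2` and `0 < γ < 1/2` the minimum is attained at the unique `α ∈ (0, 1)` with
`γ = α ((1 + α) ^ (k - 1) - (1 - α) ^ (k - 1)) / ((1 + α) ^ k + (1 - α) ^ k)`.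
Writing `α = 1 - 2 δ`, this is `F(k, γ) = ψ(k, γ) + (k / 2) h(γ)` where
`ψ(k, γ) = k - 1 + log₂ ((1 - δ) ^ k + δ ^ k) - (k / 2) h(γ) - k γ log₂ (1 - 2 δ)`
is the exponent of the normalized `k`-th norm of the Krawchouk polynomial. -/
def momentExponent (k : ℕ) (γ : ℝ) : ℝ :=
  ⨅ α : Set.Ioo (0 : ℝ) 1,
    (Real.logb 2 (((1 + (α : ℝ)) ^ k + (1 - (α : ℝ)) ^ k) / 2) - k * γ * Real.logb 2 (α : ℝ))

/-- The number `X = |L ∩ C|` of words of Hamming weight `i` in the binary linear code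
`C = {x ∈ 𝔽₂ⁿ : M x = 0}` with parity check matrix `M`. -/
def weightCount {m n : ℕ} (i : ℕ) (M : Matrix (Fin m) (Fin n) (ZMod 2)) : ℕ :=
  (Finset.univ.filter fun x : Fin n → ZMod 2 => hammingNorm x = i ∧ M.mulVec x = 0).card

/-- The mean `𝔼 X`, for a uniformly random `m × n` binary matrix `M`. -/
def meanCount (m n i : ℕ) : ℝ :=
  𝔼 M : Matrix (Fin m) (Fin n) (ZMod 2), (weightCount i M : ℝ)

/-- The central moment `𝔼 (X - 𝔼 X) ^ k`, for a uniformly random `m × n` binary matrix `M`. -/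
def centralMomentCount (m n i k : ℕ) : ℝ :=
  𝔼 M : Matrix (Fin m) (Fin n) (ZMod 2), ((weightCount i M : ℝ) - meanCount m n i) ^ k

/-- The variance of `X`. -/
def varianceCount (m n i : ℕ) : ℝ := centralMomentCount m n i 2

/-- The normalized central moment `𝔼 (X - 𝔼 X) ^ k / Var(X) ^ (k / 2)`. -/
def normalizedMoment (m n i k : ℕ) : ℝ :=
  centralMomentCount m n i k / varianceCount m n i ^ ((k : ℝ) / 2)

/-- The exponent `F(k, γ) - (k / 2) h(γ) - (k / 2 - 1) λ`. -/
def normalizedExponent (k : ℕ) (γ lam : ℝ) : ℝ :=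
  momentExponent k γ - (k : ℝ) / 2 * binaryEntropy γ - ((k : ℝ) / 2 - 1) * lam

end

/-! Expanding the indicator of `M x = 0` in characters turns the `k`-th central moment into `2 ^ (-m
k)` times a count (`centralMomentCount_eq`): families of pairs `(x_j, u_j)`, with `x_j` of weight
`i` and `u_j ≠ 0`, whose tensors `u_j ⊗ x_j` sum to zero. Taking all `u_j` equal gives `(2 ^ m - 1)
N`, where `N` counts the `k`-tuples of words of weight `i` with zero sum. The theorem says that
these families dominate and that `N` is about `2 ^ (F n)`; the case `k = 2` gives the variance.

Dominance (`card_tensorRelations_le`, `card_tensorRelations_le_two_rpow`): if the `u_j` span a space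
of dimension `d`, the words satisfy `d` independent linear relations. Against `d = 1`, each further
dimension gains `2 ^ m` choices of functional but loses a free word, a factor `2 ^ (h n)`, hence a
net loss of at least `2 ^ (ε n)`. This beats the `2 ^ (d k)` coefficient matrices when `k ≤ c n`.
One relation is kept as a zero-sum condition on at least `k / d` words, to save the factor `2 ^
(-n)` that `N` also carries.

The bound `N ≤ 2 ^ (F n)` is the generating function bound, read coordinate by coordinate: each
coordinate of a zero-sum family is an even vector of length `k`. The converse has two regimes. For
`k ^ 3 ≤ η n` (`exists_lower_bound_of_pow_three_le`) the coordinates are sampled from the tilted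
measure on even vectors, Chebyshev controls all `k` weights, and a short block of extra coordinates
corrects them exactly. For larger `k` (`choose_pow_le_card_zeroSumFamilies_mul`), `2 ^ n N` is the
`k`-th power sum of Krawtchouk values; the all-zero and all-one vectors contribute `2 (n choose i) ^
k`, the others at most half of that in absolute value, and `F` is already close to `k h - 1`. -/

section

open Finset

/-! ### The sign character of `ZMod 2` -/

/-- The nontrivial character of `ZMod 2`. -/
noncomputable def binarySign (a : ZMod 2) : ℝ := if a = 0 then 1 else -1

@[simp] lemma binarySign_zero : binarySign 0 = 1 := by simp [binarySign]

@[simp] lemma binarySign_one : binarySign 1 = -1 := by simp [binarySign]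

lemma zmod_two_eq (a : ZMod 2) : a = 0 ∨ a = 1 := by
  revert a; decide

lemma sum_zmod_two {M : Type*} [AddCommMonoid M] (f : ZMod 2 → M) : ∑ a, f a = f 0 + f 1 :=
  Fin.sum_univ_two f

lemma binarySign_add (a b : ZMod 2) : binarySign (a + b) = binarySign a * binarySign b := by
  rcases zmod_two_eq a with rfl | rfl <;> rcases zmod_two_eq b with rfl | rfl <;>
    simp [show (1 : ZMod 2) + 1 = 0 from by decide]

lemma binarySign_sum {κ : Type*} (s : Finset κ) (v : κ → ZMod 2) :
    binarySign (∑ j ∈ s, v j) = ∏ j ∈ s, binarySign (v j) := by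
  classical
  induction s using Finset.induction_on with
  | empty => simp
  | insert a s ha ih => rw [sum_insert ha, prod_insert ha, binarySign_add, ih]

lemma indicator_zero_eq (a : ZMod 2) : (if a = 0 then (1 : ℝ) else 0) = (1 + binarySign a) / 2 := by
  rcases zmod_two_eq a with rfl | rfl <;> simp

/-! ### Even vectors, zero-sum families and the generating function bound -/

section Weights

variable {κ ι : Type*} [Fintype κ] [Fintype ι]

/-- The parity constraint is the average of the trivial and the sign character, and each of the two
sums factors. -/
lemma sum_even_prod [DecidableEq κ] (a : κ → ZMod 2 → ℝ) :
    ∑ v : κ → ZMod 2, (if ∑ j, v j = 0 then ∏ j, a j (v j) else 0) =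
      (∏ j, (a j 0 + a j 1) + ∏ j, (a j 0 - a j 1)) / 2 := by
  have h : ∀ v : κ → ZMod 2, (if ∑ j, v j = 0 then ∏ j, a j (v j) else 0) =
      (∏ j, a j (v j) + ∏ j, a j (v j) * binarySign (v j)) / 2 := by
    intro v
    have := indicator_zero_eq (∑ j, v j)
    rw [binarySign_sum] at this
    rw [prod_mul_distrib, ← mul_one_add, mul_div_assoc, ← this]
    simp
  simp_rw [h]
  rw [← sum_div, sum_add_distrib, ← Fintype.prod_sum, ← Fintype.prod_sum (fun j t => a j t * binarySign t)]
  simp [sum_zmod_two, sub_eq_add_neg]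

lemma pow_hammingNorm (α : ℝ) (v : κ → ZMod 2) :
    α ^ hammingNorm v = ∏ j, (if v j = 0 then 1 else α) := by
  rw [hammingNorm, prod_ite]
  simp

/-- The weight `α ^ |v|` restricted to vectors with zero sum. -/
noncomputable def evenWeight (α : ℝ) (v : κ → ZMod 2) : ℝ := if ∑ j, v j = 0 then α ^ hammingNorm v else 0

/-- The total mass `((1 + α) ^ k + (1 - α) ^ k) / 2` of `evenWeight α` on words of length `k`. -/
noncomputable def evenMass (α : ℝ) (k : ℕ) : ℝ := ((1 + α) ^ k + (1 - α) ^ k) / 2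

lemma evenWeight_nonneg {α : ℝ} (hα : 0 ≤ α) (v : κ → ZMod 2) : 0 ≤ evenWeight α v := by
  unfold evenWeight; split_ifs <;> positivity

lemma sum_evenWeight [DecidableEq κ] (α : ℝ) :
    ∑ v : κ → ZMod 2, evenWeight α v = evenMass α (Fintype.card κ) := by
  have := sum_even_prod (κ := κ) (fun _ t => if t = 0 then (1 : ℝ) else α)
  simp only [evenWeight, pow_hammingNorm]
  rw [this]
  simp [evenMass]

/-- The unnormalised probability that entry `j` equals `1` under the tilted measure; `exists_tilt`
makes it `γ` times the total mass. -/
lemma sum_evenWeight_mul_indicator [DecidableEq κ] (α : ℝ) (j : κ) :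
    ∑ v : κ → ZMod 2, evenWeight α v * (if v j = 0 then 0 else 1) =
      α * ((1 + α) ^ (Fintype.card κ - 1) - (1 - α) ^ (Fintype.card κ - 1)) / 2 := by
  have := sum_even_prod (κ := κ)
    (fun l t => (if t = 0 then (1 : ℝ) else α) * if l = j then (if t = 0 then 0 else 1) else 1)
  simp only [evenWeight, pow_hammingNorm, ite_mul, zero_mul]
  convert this using 1
  · refine sum_congr rfl fun v _ => ?_
    rw [prod_mul_distrib]
    simp only [prod_ite_eq', mem_univ, if_true]
  · rw [← mul_prod_erase univ _ (mem_univ j), ← mul_prod_erase univ _ (mem_univ j)]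
    have h1 : ∀ (f g : κ → ℝ) (c : ℝ), (∀ l, l ≠ j → f l = c) → ∏ l ∈ univ.erase j, f l =
        c ^ (Fintype.card κ - 1) := by
      intro f g c hf
      rw [prod_congr rfl fun l hl => hf l (ne_of_mem_erase hl), prod_const,
        card_erase_of_mem (mem_univ j), card_univ]
    rw [h1 _ (fun _ => 0) (1 + α) (by intro l hl; simp [hl]),
      h1 _ (fun _ => 0) (1 - α) (by intro l hl; simp [hl])]
    simp
    ring

/-- The words of Hamming weight `i`. -/
def layer (ι : Type*) [Fintype ι] [DecidableEq ι] (i : ℕ) : Finset (ι → ZMod 2) :=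
  univ.filter fun x => hammingNorm x = i

@[simp] lemma mem_layer [DecidableEq ι] {i : ℕ} {x : ι → ZMod 2} :
    x ∈ layer ι i ↔ hammingNorm x = i := by simp [layer]

lemma card_layer [DecidableEq ι] (i : ℕ) : (layer ι i).card = (Fintype.card ι).choose i := by
  classical
  rw [← card_univ, ← card_powersetCard]
  refine card_bij' (fun x _ => univ.filter fun r => x r ≠ 0) (fun s _ r => if r ∈ s then 1 else 0)
    ?_ ?_ ?_ ?_
  · intro x hx
    simpa [mem_powersetCard, hammingNorm] using hx
  · intro s hs
    simpa [mem_powersetCard, hammingNorm] using hs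
  · intro x hx
    ext r
    rcases zmod_two_eq (x r) with h | h <;> simp [h]
  · intro s hs
    ext r
    simp

/-- The families of words of weight `i`, indexed by `κ`, that sum to zero. -/
def zeroSumFamilies (κ ι : Type*) [Fintype κ] [Fintype ι] [DecidableEq κ] [DecidableEq ι] (i : ℕ) :
    Finset (κ → ι → ZMod 2) :=
  univ.filter fun x => (∀ j, hammingNorm (x j) = i) ∧ ∑ j, x j = 0

@[simp] lemma mem_zeroSumFamilies [DecidableEq κ] [DecidableEq ι] {i : ℕ} {x : κ → ι → ZMod 2} :
    x ∈ zeroSumFamilies κ ι i ↔ (∀ j, hammingNorm (x j) = i) ∧ ∑ j, x j = 0 := by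
  simp [zeroSumFamilies]

lemma prod_evenWeight_transpose (α : ℝ) {x : κ → ι → ZMod 2} (hx : ∑ j, x j = 0) :
    ∏ r, evenWeight α (fun j => x j r) = α ^ ∑ j, hammingNorm (x j) := by
  have : ∀ r, evenWeight α (fun j => x j r) = ∏ j, (if x j r = 0 then 1 else α) := by
    intro r
    have h := congrFun hx r
    rw [Finset.sum_apply] at h
    rw [evenWeight, if_pos (by simpa using h), pow_hammingNorm]
  simp_rw [this]
  rw [prod_comm, ← prod_pow_eq_pow_sum]
  simp_rw [pow_hammingNorm]

lemma sum_prod_evenWeight [DecidableEq κ] [DecidableEq ι] (α : ℝ) :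
    ∑ Z : ι → κ → ZMod 2, ∏ r, evenWeight α (Z r) =
      evenMass α (Fintype.card κ) ^ Fintype.card ι := by
  rw [← Fintype.prod_sum (fun (_ : ι) (v : κ → ZMod 2) => evenWeight α v)]
  simp [sum_evenWeight]

/-- Transposing a zero-sum family gives one even vector per coordinate, and the product of their
tilted weights is `α ^ (k i)`. Summing over all choices of even vectors only adds nonnegative terms.
-/
lemma card_zeroSumFamilies_mul_le [DecidableEq κ] [DecidableEq ι] {α : ℝ} (hα : 0 ≤ α) (i : ℕ) :
    ((zeroSumFamilies κ ι i).card : ℝ) * α ^ (Fintype.card κ * i) ≤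
      evenMass α (Fintype.card κ) ^ Fintype.card ι := by
  rw [← sum_prod_evenWeight (κ := κ) (ι := ι), ← nsmul_eq_mul, ← sum_const]
  calc ∑ _x ∈ zeroSumFamilies κ ι i, α ^ (Fintype.card κ * i)
      = ∑ x ∈ zeroSumFamilies κ ι i, ∏ r, evenWeight α (fun j => x j r) := by
        refine sum_congr rfl fun x hx => ?_
        rw [mem_zeroSumFamilies] at hx
        rw [prod_evenWeight_transpose α hx.2]
        simp [hx.1]
    _ = ∑ Z ∈ (zeroSumFamilies κ ι i).image (fun x r j => x j r), ∏ r, evenWeight α (Z r) := by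
        rw [sum_image]
        intro x _ y _ h
        ext j r
        exact congrFun (congrFun h r) j
    _ ≤ _ := sum_le_sum_of_subset_of_nonneg (subset_univ _) fun Z _ _ =>
        prod_nonneg fun r _ => evenWeight_nonneg hα _

lemma card_zeroSumFamilies_congr {ι' : Type*} [Fintype ι'] [DecidableEq κ] [DecidableEq ι]
    [DecidableEq ι'] (e : ι ≃ ι') (i : ℕ) :
    (zeroSumFamilies κ ι i).card = (zeroSumFamilies κ ι' i).card := by
  have hn : ∀ y : ι' → ZMod 2, hammingNorm (fun r => y (e r)) = hammingNorm y := by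
    intro y
    simp only [hammingNorm]
    refine card_bij (fun r _ => e r) (by simp) (by simp) ?_
    intro r hr
    exact ⟨e.symm r, by simpa using hr, by simp⟩
  refine card_bij' (fun x _ j r => x j (e.symm r)) (fun y _ j r => y j (e r)) ?_ ?_ ?_ ?_
  · intro x hx
    rw [mem_zeroSumFamilies] at hx ⊢
    refine ⟨fun j => ?_, ?_⟩
    · rw [← hn]; simpa using hx.1 j
    · ext r
      simpa using congrFun hx.2 (e.symm r)
  · intro x hx
    rw [mem_zeroSumFamilies] at hx ⊢
    refine ⟨fun j => ?_, ?_⟩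
    · rw [hn]; exact hx.1 j
    · ext r
      simpa using congrFun hx.2 (e r)
  · intro x _; simp
  · intro x _; simp

end Weights

/-! ### Binomial coefficients, entropy and the exponent `F` -/

section Entropy

lemma binaryEntropy_eq_div (t : ℝ) : binaryEntropy t = Real.binEntropy t / Real.log 2 := by
  simp only [binaryEntropy, Real.binEntropy, Real.logb, one_div]
  ring

lemma two_rpow_binaryEntropy_mul {γ : ℝ} (h0 : 0 < γ) (h1 : γ < 1) {n i : ℕ} (hi : (i : ℝ) = γ * n) :
    (2 : ℝ) ^ (binaryEntropy γ * n) * (γ ^ i * (1 - γ) ^ (n - i)) = 1 := by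
  have h2 : 0 < 1 - γ := by linarith
  have hin : i ≤ n := by
    have : (i : ℝ) ≤ n := by rw [hi]; nlinarith [Nat.cast_nonneg (α := ℝ) n]
    exact_mod_cast this
  have e1 : γ ^ i = (2 : ℝ) ^ (Real.logb 2 γ * i) := by
    rw [Real.rpow_mul (by norm_num), Real.rpow_logb (by norm_num) (by norm_num) h0,
      Real.rpow_natCast]
  have e2 : (1 - γ) ^ (n - i) = (2 : ℝ) ^ (Real.logb 2 (1 - γ) * (n - i : ℕ)) := by
    rw [Real.rpow_mul (by norm_num), Real.rpow_logb (by norm_num) (by norm_num) h2,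
      Real.rpow_natCast]
  rw [e1, e2, ← Real.rpow_add (by norm_num), ← Real.rpow_add (by norm_num), Nat.cast_sub hin, hi]
  rw [show binaryEntropy γ * n + (Real.logb 2 γ * (γ * n) + Real.logb 2 (1 - γ) * (n - γ * n)) = 0 by
    simp only [binaryEntropy, one_div, Real.logb_inv]; ring]
  simp

lemma choose_mul_pow_le_one {γ : ℝ} (h0 : 0 ≤ γ) (h1 : γ ≤ 1) {n i : ℕ} (hin : i ≤ n) :
    (n.choose i : ℝ) * (γ ^ i * (1 - γ) ^ (n - i)) ≤ 1 := by
  have h2 : 0 ≤ 1 - γ := by linarith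
  have h := add_pow γ (1 - γ) n
  rw [add_sub_cancel, one_pow] at h
  refine le_of_le_of_eq ?_ h.symm
  have := single_le_sum (f := fun m => γ ^ m * (1 - γ) ^ (n - m) * (n.choose m : ℝ))
    (fun m _ => by positivity) (mem_range.2 (Nat.lt_succ_of_le hin))
  simpa [mul_comm] using this

/-- The binomial distribution with parameter `γ` is unimodal with a mode at its integer mean `i`, so
this is the largest of `n + 1` terms summing to `1`. -/
lemma one_le_succ_mul_choose_mul_pow {γ : ℝ} (h0 : 0 < γ) (h1 : γ < 1) {n i : ℕ}
    (hi : (i : ℝ) = γ * n) :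
    1 ≤ (n + 1 : ℝ) * (n.choose i * (γ ^ i * (1 - γ) ^ (n - i))) := by
  have h2 : 0 < 1 - γ := by linarith
  have hin : i ≤ n := by
    have : (i : ℝ) ≤ n := by rw [hi]; nlinarith [Nat.cast_nonneg (α := ℝ) n]
    exact_mod_cast this
  set t : ℕ → ℝ := fun m => γ ^ m * (1 - γ) ^ (n - m) * (n.choose m : ℝ) with ht
  have htp : ∀ m, 0 ≤ t m := fun m => by simp only [ht]; positivity
  have step : ∀ m, m < n → t (m + 1) * ((m + 1) * (1 - γ)) = t m * ((n - m) * γ) := by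
    intro m hm
    have hc : (n.choose (m + 1) : ℝ) * (m + 1) = n.choose m * (n - m) := by
      have := Nat.choose_succ_right_eq n m
      rw [← Nat.cast_sub hm.le]
      exact_mod_cast this
    have hp : (1 - γ) ^ (n - m) = (1 - γ) ^ (n - (m + 1)) * (1 - γ) := by
      rw [← pow_succ]; congr 1; omega
    simp only [ht]
    rw [hp, pow_succ]
    linear_combination γ ^ m * γ * (1 - γ) ^ (n - (m + 1)) * (1 - γ) * hc
  have hup : ∀ m, m < i → t m ≤ t (m + 1) := by
    intro m hm
    have hmi : (m : ℝ) + 1 ≤ γ * n := by rw [← hi]; exact_mod_cast hm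
    have hs := step m (by omega)
    have hpos : 0 < ((m : ℝ) + 1) * (1 - γ) := by positivity
    have hle : ((m : ℝ) + 1) * (1 - γ) ≤ (n - m) * γ := by nlinarith
    have := mul_le_mul_of_nonneg_left hle (htp m)
    rw [← hs] at this
    exact le_of_mul_le_mul_right this hpos
  have hdown : ∀ m, i ≤ m → m < n → t (m + 1) ≤ t m := by
    intro m hm hmn
    have hmi : γ * n ≤ m := by rw [← hi]; exact_mod_cast hm
    have hs := step m hmn
    have hpos : 0 < ((m : ℝ) + 1) * (1 - γ) := by positivity
    have hle : (n - m) * γ ≤ ((m : ℝ) + 1) * (1 - γ) := by nlinarith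
    have := mul_le_mul_of_nonneg_left hle (htp m)
    rw [← hs] at this
    exact le_of_mul_le_mul_right this hpos
  have hmax1 : ∀ d, d ≤ i → t (i - d) ≤ t i := by
    intro d
    induction d with
    | zero => simp
    | succ d ih =>
      intro hd
      have := hup (i - (d + 1)) (by omega)
      rw [show i - (d + 1) + 1 = i - d by omega] at this
      exact this.trans (ih (by omega))
  have hmax2 : ∀ d, i + d ≤ n → t (i + d) ≤ t i := by
    intro d
    induction d with
    | zero => simp
    | succ d ih =>
      intro hd
      exact (hdown (i + d) (by omega) (by omega)).trans (ih (by omega))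
  have h := add_pow γ (1 - γ) n
  rw [add_sub_cancel, one_pow] at h
  calc (1 : ℝ) = ∑ m ∈ range (n + 1), t m := h
    _ ≤ ∑ m ∈ range (n + 1), t i := by
      refine sum_le_sum fun m hm => ?_
      rw [mem_range] at hm
      rcases le_total m i with hmi | hmi
      · have := hmax1 (i - m) (by omega)
        rwa [show i - (i - m) = m by omega] at this
      · have := hmax2 (m - i) (by omega)
        rwa [show i + (m - i) = m by omega] at this
    _ = _ := by simp only [ht, sum_const, card_range, nsmul_eq_mul]; push_cast; ring

lemma choose_le_two_rpow {γ : ℝ} (h0 : 0 < γ) (h1 : γ < 1) {n i : ℕ} (hi : (i : ℝ) = γ * n) :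
    (n.choose i : ℝ) ≤ 2 ^ (binaryEntropy γ * n) := by
  have h2 : 0 < 1 - γ := by linarith
  have hin : i ≤ n := by
    have : (i : ℝ) ≤ n := by rw [hi]; nlinarith [Nat.cast_nonneg (α := ℝ) n]
    exact_mod_cast this
  have e := two_rpow_binaryEntropy_mul h0 h1 hi
  have := choose_mul_pow_le_one h0.le h1.le hin
  exact le_of_mul_le_mul_right (this.trans_eq e.symm) (by positivity)

lemma two_rpow_le_succ_mul_choose {γ : ℝ} (h0 : 0 < γ) (h1 : γ < 1) {n i : ℕ}
    (hi : (i : ℝ) = γ * n) :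
    (2 : ℝ) ^ (binaryEntropy γ * n) ≤ (n + 1) * n.choose i := by
  have h2 : 0 < 1 - γ := by linarith
  have e := two_rpow_binaryEntropy_mul h0 h1 hi
  have := one_le_succ_mul_choose_mul_pow h0 h1 hi
  rw [← mul_assoc] at this
  exact le_of_mul_le_mul_right (e.trans_le this) (by positivity)

/-- The function minimised in `momentExponent`. -/
noncomputable def exponentAt (k : ℕ) (γ α : ℝ) : ℝ :=
  Real.logb 2 (((1 + α) ^ k + (1 - α) ^ k) / 2) - k * γ * Real.logb 2 α

lemma evenMass_pos {α : ℝ} (h0 : 0 < α) (h1 : α < 1) (k : ℕ) : 0 < evenMass α k := by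
  have : 0 < 1 - α := by linarith
  unfold evenMass; positivity

lemma two_rpow_exponentAt_mul {γ α : ℝ} (h0 : 0 < α) (h1 : α < 1) (k : ℕ) {n i : ℕ}
    (hi : (i : ℝ) = γ * n) :
    (2 : ℝ) ^ (exponentAt k γ α * n) * α ^ (k * i) = evenMass α k ^ n := by
  have hG := evenMass_pos h0 h1 k
  have e1 : α ^ (k * i) = (2 : ℝ) ^ (Real.logb 2 α * (k * i : ℕ)) := by
    rw [Real.rpow_mul (by norm_num), Real.rpow_logb (by norm_num) (by norm_num) h0,
      Real.rpow_natCast]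
  have e2 : evenMass α k ^ n = (2 : ℝ) ^ (Real.logb 2 (evenMass α k) * n) := by
    rw [Real.rpow_mul (by norm_num), Real.rpow_logb (by norm_num) (by norm_num) hG,
      Real.rpow_natCast]
  rw [e1, e2, ← Real.rpow_add (by norm_num)]
  congr 1
  push_cast
  rw [hi, exponentAt, evenMass]
  ring

/-- Drop `(1 - α) ^ k` and apply Gibbs' inequality. This gives both the comparison of `F` with `k h
- 1` and the boundedness below that the infimum requires. -/
lemma mul_binaryEntropy_sub_one_le_exponentAt {γ α : ℝ} (h0 : 0 < γ) (h1 : γ < 1) (ha : 0 < α)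
    (ha1 : α < 1) (k : ℕ) : k * binaryEntropy γ - 1 ≤ exponentAt k γ α := by
  have h2 : 0 < 1 - γ := by linarith
  have ha2 : 0 < 1 - α := by linarith
  have l2 : 0 < Real.log 2 := Real.log_pos (by norm_num)
  have key : Real.binEntropy γ ≤ Real.log (1 + α) - γ * Real.log α := by
    have t1 := Real.log_le_sub_one_of_pos (x := α / (γ * (1 + α))) (by positivity)
    have t2 := Real.log_le_sub_one_of_pos (x := 1 / ((1 - γ) * (1 + α))) (by positivity)
    rw [Real.log_div (by positivity) (by positivity), Real.log_mul (by positivity) (by positivity)]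
      at t1
    rw [Real.log_div (by positivity) (by positivity), Real.log_mul (by positivity) (by positivity),
      Real.log_one] at t2
    have t3 := add_le_add (mul_le_mul_of_nonneg_left t1 h0.le) (mul_le_mul_of_nonneg_left t2 h2.le)
    have : γ * (α / (γ * (1 + α)) - 1) + (1 - γ) * (1 / ((1 - γ) * (1 + α)) - 1) = 0 := by
      field_simp; ring
    rw [this] at t3
    simp only [Real.binEntropy, Real.log_inv]
    linarith
  have hm : (1 + α) ^ k / 2 ≤ ((1 + α) ^ k + (1 - α) ^ k) / 2 := by
    have : 0 ≤ (1 - α) ^ k := by positivity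
    linarith
  have hl : Real.logb 2 ((1 + α) ^ k / 2) ≤ Real.logb 2 (((1 + α) ^ k + (1 - α) ^ k) / 2) :=
    Real.logb_le_logb_of_le (by norm_num) (by positivity) hm
  rw [Real.logb_div (by positivity) (by norm_num), Real.logb_pow, Real.logb_self_eq_one (by norm_num)]
    at hl
  unfold exponentAt
  rw [binaryEntropy_eq_div]
  have key2 : Real.binEntropy γ / Real.log 2 ≤ Real.logb 2 (1 + α) - γ * Real.logb 2 α := by
    simp only [Real.logb]
    rw [← mul_div_assoc, ← sub_div]
    gcongr
  have := mul_le_mul_of_nonneg_left key2 (Nat.cast_nonneg (α := ℝ) k)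
  linarith

lemma momentExponent_le {γ α : ℝ} (h0 : 0 < γ) (h1 : γ < 1) (ha : 0 < α) (ha1 : α < 1) (k : ℕ) :
    momentExponent k γ ≤ exponentAt k γ α := by
  refine ciInf_le (f := fun α : Set.Ioo (0 : ℝ) 1 => exponentAt k γ α)
    ⟨k * binaryEntropy γ - 1, ?_⟩ ⟨α, ha, ha1⟩
  rintro _ ⟨β, rfl⟩
  exact mul_binaryEntropy_sub_one_le_exponentAt h0 h1 β.2.1 β.2.2 k

lemma le_momentExponent {γ c : ℝ} {k : ℕ} (h : ∀ α, 0 < α → α < 1 → c ≤ exponentAt k γ α) :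
    c ≤ momentExponent k γ := by
  have : Nonempty (Set.Ioo (0 : ℝ) 1) := ⟨⟨1 / 2, by norm_num, by norm_num⟩⟩
  exact le_ciInf (f := fun α : Set.Ioo (0 : ℝ) 1 => exponentAt k γ α)
    fun β => h β β.2.1 β.2.2

lemma mul_binaryEntropy_sub_one_le_momentExponent {γ : ℝ} (h0 : 0 < γ) (h1 : γ < 1) (k : ℕ) :
    k * binaryEntropy γ - 1 ≤ momentExponent k γ :=
  le_momentExponent fun _ ha ha1 => mul_binaryEntropy_sub_one_le_exponentAt h0 h1 ha ha1 k

/-- The odds `γ / (1 - γ)` give equality in Gibbs' inequality, so they miss the lower bound `k h -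
1` only by a term that decays with `k`. -/
lemma exponentAt_odds {γ : ℝ} (h0 : 0 < γ) (h1 : γ < 1 / 2) (k : ℕ) :
    exponentAt k γ (γ / (1 - γ)) =
      k * binaryEntropy γ - 1 + Real.logb 2 (1 + (1 - 2 * γ) ^ k) := by
  have h2 : 0 < 1 - γ := by linarith
  have h3 : 0 < 1 - 2 * γ := by linarith
  have e : ((1 + γ / (1 - γ)) ^ k + (1 - γ / (1 - γ)) ^ k) / 2 =
      ((1 - γ) ^ k)⁻¹ * (1 + (1 - 2 * γ) ^ k) / 2 := by
    rw [show 1 + γ / (1 - γ) = (1 - γ)⁻¹ by field_simp; ring,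
      show 1 - γ / (1 - γ) = (1 - γ)⁻¹ * (1 - 2 * γ) by field_simp; ring, mul_pow, inv_pow]
    ring
  rw [exponentAt, e, Real.logb_div (by positivity) (by norm_num),
    Real.logb_mul (by positivity) (by positivity), Real.logb_inv, Real.logb_pow,
    Real.logb_div h0.ne' h2.ne', Real.logb_self_eq_one (by norm_num)]
  simp only [binaryEntropy, one_div, Real.logb_inv]
  ring

variable {κ ι : Type*} [Fintype κ] [Fintype ι] [DecidableEq κ] [DecidableEq ι]

lemma card_zeroSumFamilies_le_exponentAt {γ α : ℝ} (ha : 0 < α) (ha1 : α < 1) {i : ℕ}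
    (hi : (i : ℝ) = γ * Fintype.card ι) :
    ((zeroSumFamilies κ ι i).card : ℝ) ≤
      2 ^ (exponentAt (Fintype.card κ) γ α * Fintype.card ι) := by
  have := card_zeroSumFamilies_mul_le (κ := κ) (ι := ι) ha.le i
  rw [← two_rpow_exponentAt_mul ha ha1 _ hi] at this
  exact le_of_mul_le_mul_right this (by positivity)

lemma card_zeroSumFamilies_le_momentExponent {γ : ℝ} {i : ℕ} (hn : 0 < Fintype.card ι)
    (hi : (i : ℝ) = γ * Fintype.card ι) :
    ((zeroSumFamilies κ ι i).card : ℝ) ≤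
      2 ^ (momentExponent (Fintype.card κ) γ * Fintype.card ι) := by
  rcases Nat.eq_zero_or_pos (zeroSumFamilies κ ι i).card with h | h
  · rw [h]; simp only [Nat.cast_zero]; positivity
  have hp : (0 : ℝ) < (zeroSumFamilies κ ι i).card := by exact_mod_cast h
  have hn' : (0 : ℝ) < Fintype.card ι := by exact_mod_cast hn
  -- Taking logarithms lets the bound for every `α` pass to the infimum, whether or not it is
  -- attained.
  rw [← Real.logb_le_iff_le_rpow (by norm_num) hp, ← div_le_iff₀ hn']
  refine le_momentExponent fun α ha ha1 => ?_
  rw [div_le_iff₀ hn', Real.logb_le_iff_le_rpow (by norm_num) hp]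
  exact card_zeroSumFamilies_le_exponentAt ha ha1 hi

end Entropy

/-! ### Central moments as counts of tensor relations -/

section Moments

variable {κ ι μ : Type*} [Fintype κ] [Fintype ι] [Fintype μ] [DecidableEq ι]
  [DecidableEq μ]

lemma sum_prod_binarySign (y : μ → ZMod 2) :
    ∑ u : μ → ZMod 2, binarySign (∑ a, u a * y a) = if y = 0 then (2 : ℝ) ^ Fintype.card μ else 0 := by
  simp_rw [binarySign_sum]
  rw [← Fintype.prod_sum (fun a t => binarySign (t * y a))]
  simp only [sum_zmod_two, zero_mul, one_mul, binarySign_zero]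
  split_ifs with h
  · subst h
    simp [one_add_one_eq_two]
  · obtain ⟨a, ha⟩ : ∃ a, y a ≠ 0 := by
      by_contra! hc
      exact h (funext hc)
    refine prod_eq_zero (mem_univ a) ?_
    rcases zmod_two_eq (y a) with h' | h'
    · exact absurd h' ha
    · simp [h']

/-- The exponent is linear in `M`, with coefficients the entries of `∑ u_j ⊗ x_j`. The rows of `M`
range independently, and each row sum vanishes unless its coefficients do. -/
lemma expect_prod_binarySign (x : κ → ι → ZMod 2) (u : κ → μ → ZMod 2) :
    𝔼 M : Matrix μ ι (ZMod 2), ∏ j, binarySign (∑ a, u j a * M.mulVec (x j) a) =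
      if ∀ a b, ∑ j, u j a * x j b = 0 then (1 : ℝ) else 0 := by
  have h1 : ∀ M : Matrix μ ι (ZMod 2), ∏ j, binarySign (∑ a, u j a * M.mulVec (x j) a) =
      ∏ a, binarySign (∑ b, M a b * ∑ j, u j a * x j b) := by
    intro M
    rw [← binarySign_sum, ← binarySign_sum]
    congr 1
    simp only [Matrix.mulVec, dotProduct, mul_sum]
    rw [sum_comm]
    refine sum_congr rfl fun a _ => ?_
    rw [sum_comm]
    refine sum_congr rfl fun b _ => sum_congr rfl fun j _ => ?_
    ring
  simp_rw [h1]
  rw [Fintype.expect_eq_sum_div_card]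
  have h2 : ∑ M : Matrix μ ι (ZMod 2), ∏ a, binarySign (∑ b, M a b * ∑ j, u j a * x j b) =
      ∏ a, ∑ row : ι → ZMod 2, binarySign (∑ b, row b * ∑ j, u j a * x j b) :=
    (Fintype.prod_sum (fun a (row : ι → ZMod 2) =>
      binarySign (∑ b, row b * ∑ j, u j a * x j b))).symm
  rw [h2]
  have h3 : ∀ a, ∑ row : ι → ZMod 2, binarySign (∑ b, row b * ∑ j, u j a * x j b) =
      if ∀ b, ∑ j, u j a * x j b = 0 then (2 : ℝ) ^ Fintype.card ι else 0 := by
    intro a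
    rw [sum_prod_binarySign (fun b => ∑ j, u j a * x j b)]
    simp [funext_iff]
  simp_rw [h3]
  have hc : (Fintype.card (Matrix μ ι (ZMod 2)) : ℝ) = ∏ _a : μ, (2 : ℝ) ^ Fintype.card ι := by
    have : Fintype.card (Matrix μ ι (ZMod 2)) = Fintype.card (μ → ι → ZMod 2) := rfl
    rw [this]
    simp
  split_ifs with h
  · rw [hc, prod_congr rfl fun a _ => if_pos (h a)]
    exact div_self (prod_ne_zero_iff.2 fun _ _ => by positivity)
  · push Not at h
    obtain ⟨a, b, hab⟩ := h
    rw [prod_eq_zero (mem_univ a) (if_neg fun hh => hab (hh b)), zero_div]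

/-- The families of pairs (word of weight `i`, nonzero functional) whose tensors sum to zero. -/
def tensorRelations (κ ι μ : Type*) [Fintype κ] [Fintype ι] [Fintype μ] [DecidableEq κ]
    [DecidableEq ι] [DecidableEq μ] (i : ℕ) : Finset (κ → (ι → ZMod 2) × (μ → ZMod 2)) :=
  univ.filter fun p => (∀ j, hammingNorm (p j).1 = i ∧ (p j).2 ≠ 0) ∧
    ∀ a b, ∑ j, (p j).2 a * (p j).1 b = 0

@[simp] lemma mem_tensorRelations [DecidableEq κ] {i : ℕ} {p : κ → (ι → ZMod 2) × (μ → ZMod 2)} :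
    p ∈ tensorRelations κ ι μ i ↔ (∀ j, hammingNorm (p j).1 = i ∧ (p j).2 ≠ 0) ∧
      ∀ a b, ∑ j, (p j).2 a * (p j).1 b = 0 := by
  simp [tensorRelations]

/-- Each indicator of `M x = 0` is an average of characters over `u`. The term `u = 0` is split off
because it is exactly the mean. -/
lemma weightCount_eq_sum {m n : ℕ} (i : ℕ) (M : Matrix (Fin m) (Fin n) (ZMod 2)) :
    (weightCount i M : ℝ) = (2 ^ m : ℝ)⁻¹ * ((layer (Fin n) i).card +
      ∑ q ∈ layer (Fin n) i ×ˢ univ.erase (0 : Fin m → ZMod 2),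
        binarySign (∑ a, q.2 a * M.mulVec q.1 a)) := by
  have h : (weightCount i M : ℝ) = ∑ x ∈ layer (Fin n) i, if M.mulVec x = 0 then (1 : ℝ) else 0 := by
    rw [weightCount, layer, sum_boole, filter_filter]
  rw [h, sum_product, card_eq_sum_ones, Nat.cast_sum, ← sum_add_distrib, mul_sum]
  refine sum_congr rfl fun x _ => ?_
  have h2 : ((1 : ℕ) : ℝ) = binarySign (∑ a, (0 : Fin m → ZMod 2) a * M.mulVec x a) := by simp
  rw [h2, add_sum_erase univ (fun u : Fin m → ZMod 2 => binarySign (∑ a, u a * M.mulVec x a))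
    (mem_univ 0), sum_prod_binarySign]
  split_ifs <;> simp

lemma meanCount_eq {m n i : ℕ} (hi : 0 < i) :
    meanCount m n i = (2 ^ m : ℝ)⁻¹ * (layer (Fin n) i).card := by
  simp_rw [meanCount, weightCount_eq_sum]
  rw [← mul_expect, expect_add_distrib, Fintype.expect_const, expect_sum_comm]
  rw [sum_eq_zero, add_zero]
  intro q hq
  have := expect_prod_binarySign (κ := Fin 1) (fun _ => q.1) (fun _ => q.2)
  simp only [univ_unique, prod_singleton, sum_singleton] at this
  rw [this, if_neg]
  intro h
  rw [mem_product, mem_layer, mem_erase] at hq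
  obtain ⟨a, ha⟩ : ∃ a, q.2 a ≠ 0 := by
    by_contra! hc
    exact hq.2.1 (funext hc)
  have hx : q.1 ≠ 0 := by
    intro h0
    rw [h0, hammingNorm_zero] at hq
    omega
  obtain ⟨b, hb⟩ : ∃ b, q.1 b ≠ 0 := by
    by_contra! hc
    exact hx (funext hc)
  exact (mul_ne_zero ha hb) (h a b)

theorem centralMomentCount_eq {m n i : ℕ} (hi : 0 < i) (k : ℕ) :
    centralMomentCount m n i k =
      ((2 : ℝ) ^ m)⁻¹ ^ k * (tensorRelations (Fin k) (Fin n) (Fin m) i).card := by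
  have h : ∀ M : Matrix (Fin m) (Fin n) (ZMod 2), ((weightCount i M : ℝ) - meanCount m n i) ^ k =
      ((2 : ℝ) ^ m)⁻¹ ^ k * ∑ p ∈ Fintype.piFinset fun _ : Fin k =>
        layer (Fin n) i ×ˢ univ.erase (0 : Fin m → ZMod 2),
        ∏ j, binarySign (∑ a, (p j).2 a * M.mulVec (p j).1 a) := by
    intro M
    rw [weightCount_eq_sum, meanCount_eq hi, ← mul_sub, add_sub_cancel_left, mul_pow, sum_pow']
  simp_rw [centralMomentCount, h]
  rw [← mul_expect, expect_sum_comm]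
  congr 1
  rw [sum_congr rfl fun p _ => expect_prod_binarySign (fun j => (p j).1) fun j => (p j).2]
  have hT : tensorRelations (Fin k) (Fin n) (Fin m) i =
      (Fintype.piFinset fun _ : Fin k => layer (Fin n) i ×ˢ univ.erase (0 : Fin m → ZMod 2)).filter
        fun p => ∀ a b, ∑ j, (p j).2 a * (p j).1 b = 0 := by
    ext p
    simp [Fintype.mem_piFinset]
  rw [hT, card_filter, Nat.cast_sum]
  simp only [Nat.cast_ite, Nat.cast_one, Nat.cast_zero]
  refine sum_congr rfl fun p _ => ?_
  congr

end Moments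

/-! ### Counting tensor relations by the rank of the functionals -/

section Relations

variable {κ ι μ : Type*} [Fintype κ] [Fintype ι] [Fintype μ] [DecidableEq κ] [DecidableEq ι]
  [DecidableEq μ]

/-- Use one common nonzero functional for all the words. -/
lemma mul_card_zeroSumFamilies_le_card_tensorRelations [Nonempty κ] (i : ℕ) :
    (2 ^ Fintype.card μ - 1) * (zeroSumFamilies κ ι i).card ≤ (tensorRelations κ ι μ i).card := by
  have h1 : (univ.erase (0 : μ → ZMod 2)).card = 2 ^ Fintype.card μ - 1 := by
    rw [card_erase_of_mem (mem_univ _), card_univ]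
    simp
  rw [← h1, ← card_product]
  refine card_le_card_of_injOn (fun q j => (q.2 j, q.1)) ?_ ?_
  · rintro ⟨u, x⟩ h
    rw [mem_coe, mem_product, mem_erase, mem_zeroSumFamilies] at h
    rw [mem_coe, mem_tensorRelations]
    refine ⟨fun j => ⟨h.2.1 j, h.1.1⟩, fun a b => ?_⟩
    have := congrFun h.2.2 b
    rw [Finset.sum_apply] at this
    simp only [← mul_sum, this]
    simp
  · rintro ⟨u, x⟩ _ ⟨u', x'⟩ _ h
    have h2 := fun j => congrFun h j
    simp only [Prod.mk.injEq] at h2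
    obtain ⟨j⟩ := ‹Nonempty κ›
    exact Prod.ext (h2 j).2 (funext fun j => (h2 j).1)

/-- Over `𝔽₂` a nonzero rank-one tensor determines both factors, since the only nonzero scalar is
`1`; so the two pairs coincide. -/
lemma card_tensorRelations_two_le {i : ℕ} (hi : 0 < i) :
    (tensorRelations (Fin 2) ι μ i).card ≤ 2 ^ Fintype.card μ * (layer ι i).card := by
  have h1 : (univ : Finset (μ → ZMod 2)).card = 2 ^ Fintype.card μ := by
    rw [card_univ]; simp
  rw [← h1, ← card_product]
  have key : ∀ p ∈ tensorRelations (Fin 2) ι μ i, p 0 = p 1 := by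
    intro p hp
    rw [mem_tensorRelations] at hp
    obtain ⟨hp1, hp2⟩ := hp
    simp only [Fin.sum_univ_two] at hp2
    obtain ⟨a, ha⟩ : ∃ a, (p 0).2 a ≠ 0 := by
      by_contra! hc
      exact (hp1 0).2 (funext hc)
    obtain ⟨b, hb⟩ : ∃ b, (p 0).1 b ≠ 0 := by
      by_contra! hc
      have := (hp1 0).1
      rw [show (p 0).1 = 0 from funext hc, hammingNorm_zero] at this
      omega
    have z : ∀ x y z w : ZMod 2, x ≠ 0 → y ≠ 0 → x * y + z * w = 0 → z = 1 ∧ w = 1 := by decide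
    have z1 : ∀ x y z w : ZMod 2, x ≠ 0 → z = 1 → x * y + z * w = 0 → y = w := by decide
    have z2 : ∀ x y z w : ZMod 2, y ≠ 0 → w = 1 → x * y + z * w = 0 → x = z := by decide
    obtain ⟨h1, h2⟩ := z _ _ _ _ ha hb (hp2 a b)
    exact Prod.ext (funext fun b' => z1 _ _ _ _ ha h1 (hp2 a b'))
      (funext fun a' => z2 _ _ _ _ hb h2 (hp2 a' b))
  refine card_le_card_of_injOn (fun p => ((p 0).2, (p 0).1)) ?_ ?_
  · intro p hp
    rw [mem_coe, mem_tensorRelations] at hp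
    simpa using (hp.1 0).1
  · intro p hp q hq h
    simp only [Prod.mk.injEq] at h
    have h0 : p 0 = q 0 := Prod.ext h.2 h.1
    funext j
    fin_cases j
    · exact h0
    · exact (key p hp).symm.trans (h0.trans (key q hq))

/-- The families of words of weight `i` satisfying the linear relations with coefficients `c`. -/
def constrainedFamilies (ι : Type*) [Fintype ι] [DecidableEq ι] (D : Finset κ) (c : κ → D → ZMod 2)
    (i : ℕ) : Finset (κ → ι → ZMod 2) :=
  univ.filter fun x => (∀ j, hammingNorm (x j) = i) ∧ ∀ t b, ∑ j, c j t * x j b = 0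

lemma exists_basis_coefficients {V : Type*} [AddCommGroup V] [Module (ZMod 2) V] (u : κ → V) :
    ∃ (D : Finset κ) (c : κ → D → ZMod 2), LinearIndependent (ZMod 2) (fun t : D => u t) ∧
      (∀ j, u j = ∑ t, c j t • u t) ∧ ∀ t s : D, c t s = if t = s then 1 else 0 := by
  obtain ⟨b, -, -, hb, hli⟩ := exists_linearIndepOn_extension (K := ZMod 2) (v := u)
    (s := ∅) (t := Set.univ) (linearIndepOn_empty _ _) (Set.subset_univ _)
  lift b to Finset κ using b.toFinite
  have h : ∀ j, ∃ f : b → ZMod 2, u j = ∑ t, f t • u t := by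
    intro j
    obtain ⟨f, hf⟩ := Submodule.mem_span_image_finset_iff_exists_fun (ZMod 2) |>.1
      (hb (Set.mem_image_of_mem u (Set.mem_univ j)))
    exact ⟨f, hf.symm⟩
  choose f hf using h
  -- On the basis the coefficients are set to unit vectors by hand, which makes that block of the
  -- matrix the identity.
  refine ⟨b, fun j => if hj : j ∈ b then Pi.single ⟨j, hj⟩ 1 else f j, hli, ?_, ?_⟩
  · intro j
    by_cases hj : j ∈ b
    · simp [hj, Pi.single_apply]
    · simp only [hj, dite_false]
      exact hf j
  · rintro ⟨t, ht⟩ s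
    simp [ht, Pi.single_apply, eq_comm]

/-- Rewriting the relation in a basis of the functionals, independence forces the word attached to
each basis element to vanish. -/
lemma exists_constraints_of_mem_tensorRelations {i : ℕ} {p : κ → (ι → ZMod 2) × (μ → ZMod 2)}
    (hp : p ∈ tensorRelations κ ι μ i) :
    ∃ (D : Finset κ) (c : κ → D → ZMod 2), (∀ t s : D, c t s = if t = s then 1 else 0) ∧
      (∀ j, c j ≠ 0) ∧ (∀ j, (p j).2 = ∑ t, c j t • (p t).2) ∧
      (fun j => (p j).1) ∈ constrainedFamilies ι D c i := by
  rw [mem_tensorRelations] at hp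
  obtain ⟨D, c, hli, hc, hδ⟩ := exists_basis_coefficients fun j => (p j).2
  refine ⟨D, c, hδ, fun j hj => ?_, hc, ?_⟩
  · apply (hp.1 j).2
    have := hc j
    simpa [hj] using this
  · rw [constrainedFamilies, mem_filter]
    refine ⟨mem_univ _, fun j => (hp.1 j).1, fun t b => ?_⟩
    rw [Fintype.linearIndependent_iff] at hli
    refine hli (fun t => ∑ j, c j t * (p j).1 b) ?_ t
    ext a
    have h := hp.2 a b
    simp only [Finset.sum_apply, Pi.smul_apply, smul_eq_mul, Pi.zero_apply]
    rw [← h]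
    simp_rw [sum_mul]
    rw [sum_comm]
    refine sum_congr rfl fun j _ => ?_
    have := congrFun (hc j) a
    simp only [Finset.sum_apply, Pi.smul_apply, smul_eq_mul] at this
    rw [this, sum_mul]
    refine sum_congr rfl fun t _ => ?_
    ring

/-- The words outside `D` determine the others: relation `s` involves a single word of `D`, namely
`s`, and can be solved for it. Relation `t` alone is retained as a zero-sum condition on its
support; the words outside `D` and off that support are counted freely. -/
lemma card_constrainedFamilies_le {D : Finset κ} {c : κ → D → ZMod 2} (i : ℕ)
    (hδ : ∀ t s : D, c t s = if t = s then 1 else 0) (t : D) :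
    (constrainedFamilies ι D c i).card ≤
      (zeroSumFamilies (univ.filter fun j => c j t ≠ 0 : Finset κ) ι i).card *
        (layer ι i).card ^ (univ.filter fun j => j ∉ D ∧ c j t = 0).card := by
  set C : Finset κ := univ.filter fun j => c j t ≠ 0 with hC
  set E : Finset κ := univ.filter fun j => j ∉ D ∧ c j t = 0 with hE
  have h1 : (layer ι i).card ^ E.card = (Fintype.piFinset fun _ : E => layer ι i).card := by
    simp
  rw [h1, ← card_product]
  refine card_le_card_of_injOn (fun x => (fun j => x j, fun j => x j)) ?_ ?_
  · intro x hx
    rw [mem_coe, constrainedFamilies, mem_filter] at hx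
    rw [mem_coe, mem_product, mem_zeroSumFamilies, Fintype.mem_piFinset]
    refine ⟨⟨fun j => hx.2.1 j, ?_⟩, fun j => mem_layer.2 (hx.2.1 j)⟩
    ext b
    rw [Finset.sum_apply, Pi.zero_apply, ← hx.2.2 t b, sum_coe_sort C (fun j => x j b), hC, sum_filter]
    refine sum_congr rfl fun j _ => ?_
    rcases zmod_two_eq (c j t) with h | h <;> simp [h]
  · intro x hx y hy h
    rw [mem_coe, constrainedFamilies, mem_filter] at hx hy
    simp only [Prod.mk.injEq] at h
    have hout : ∀ j, j ∉ D → x j = y j := by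
      intro j hj
      by_cases hc : c j t = 0
      · exact congrFun h.2 ⟨j, by simp [hE, hj, hc]⟩
      · exact congrFun h.1 ⟨j, by simp [hC, hc]⟩
    funext j
    by_cases hj : j ∈ D
    · ext b
      have e1 := hx.2.2 ⟨j, hj⟩ b
      have e2 := hy.2.2 ⟨j, hj⟩ b
      rw [← add_sum_erase _ _ (mem_univ j)] at e1 e2
      have hjj : c j ⟨j, hj⟩ = 1 := by rw [hδ ⟨j, hj⟩ ⟨j, hj⟩, if_pos rfl]
      have e3 : ∑ l ∈ univ.erase j, c l ⟨j, hj⟩ * x l b = ∑ l ∈ univ.erase j, c l ⟨j, hj⟩ * y l b := by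
        refine sum_congr rfl fun l hl => ?_
        by_cases hlD : l ∈ D
        · rw [hδ ⟨l, hlD⟩ ⟨j, hj⟩, if_neg (by simpa using ne_of_mem_erase hl), zero_mul, zero_mul]
        · rw [hout l hlD]
      rw [hjj, one_mul, e3] at e1
      rw [hjj, one_mul] at e2
      exact add_right_cancel (e1.trans e2.symm)
    · exact hout j hj

/-- The extra `1` comes from `t`, the only index lying both in `D` and in the support of relation
`t`. -/
lemma card_add_card_add_card_eq {D : Finset κ} {c : κ → D → ZMod 2}
    (hδ : ∀ t s : D, c t s = if t = s then 1 else 0) (t : D) :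
    D.card + (univ.filter fun j => c j t ≠ 0).card + (univ.filter fun j => j ∉ D ∧ c j t = 0).card =
      Fintype.card κ + 1 := by
  have h1 : D.card + (univ.filter fun j => j ∉ D).card = Fintype.card κ := by
    have := card_filter_add_card_filter_not (s := (univ : Finset κ)) (fun j => j ∈ D)
    simpa using this
  have h2 : (univ.filter fun j => j ∉ D).card =
      (univ.filter fun j => j ∉ D ∧ c j t ≠ 0).card + (univ.filter fun j => j ∉ D ∧ c j t = 0).card := by
    have := card_filter_add_card_filter_not (s := univ.filter fun j => j ∉ D) (fun j => c j t ≠ 0)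
    simp only [filter_filter, not_not] at this
    exact this.symm
  have h3 : (univ.filter fun j => c j t ≠ 0) =
      insert (t : κ) (univ.filter fun j => j ∉ D ∧ c j t ≠ 0) := by
    ext j
    simp only [mem_filter, mem_univ, true_and, mem_insert]
    by_cases hj : j ∈ D
    · rw [hδ ⟨j, hj⟩ t]
      by_cases hjt : j = t
      · subst hjt; simp
      · have : (⟨j, hj⟩ : D) ≠ t := fun h => hjt (congrArg Subtype.val h)
        simp [this, hj, hjt]
    · have : j ≠ t := fun h => hj (h ▸ t.2)
      simp [hj, this]
  rw [h3, card_insert_of_notMem (by simp)]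
  omega

/-- Pigeonhole: every index lies in the support of some relation, so the `D.card` supports cover all
of `κ`. -/
lemma exists_large_circuit [Nonempty κ] {D : Finset κ} {c : κ → D → ZMod 2} (hc : ∀ j, c j ≠ 0) :
    ∃ t : D, Fintype.card κ ≤ D.card * (univ.filter fun j => c j t ≠ 0).card := by
  obtain ⟨j₀⟩ := ‹Nonempty κ›
  have hD : (univ : Finset D).Nonempty := by
    by_contra h
    rw [not_nonempty_iff_eq_empty, univ_eq_empty_iff] at h
    exact hc j₀ (Subsingleton.elim _ _)
  obtain ⟨t, -, ht⟩ := exists_max_image univ (fun t : D => (univ.filter fun j => c j t ≠ 0).card) hD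
  refine ⟨t, ?_⟩
  calc Fintype.card κ ≤ (univ.biUnion fun t : D => univ.filter fun j => c j t ≠ 0).card := by
        rw [← card_univ]
        refine card_le_card fun j _ => ?_
        obtain ⟨s, hs⟩ : ∃ s, c j s ≠ 0 := by
          by_contra! h
          exact hc j (funext h)
        simp only [mem_biUnion, mem_filter, mem_univ, true_and]
        exact ⟨s, hs⟩
    _ ≤ ∑ s : D, (univ.filter fun j => c j s ≠ 0).card := card_biUnion_le
    _ ≤ ∑ _s : D, (univ.filter fun j => c j t ≠ 0).card := sum_le_sum fun s hs => ht s hs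
    _ = _ := by simp

theorem card_tensorRelations_le [Nonempty κ] {i : ℕ} {B : ℝ}
    (hB : ∀ (C : Finset κ) (d e : ℕ), 1 ≤ d → d + C.card + e = Fintype.card κ + 1 →
      Fintype.card κ ≤ d * C.card → ((2 : ℝ) ^ Fintype.card μ) ^ d * (2 ^ d) ^ Fintype.card κ *
        ((zeroSumFamilies C ι i).card * ((layer ι i).card : ℝ) ^ e) ≤ B) :
    ((tensorRelations κ ι μ i).card : ℝ) ≤ 2 ^ Fintype.card κ * B := by
  classical
  set S : Finset (Σ D : Finset κ, κ → D → ZMod 2) := univ.sigma fun D => univ.filter fun c =>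
    (∀ t s : D, c t s = if t = s then 1 else 0) ∧ ∀ j, c j ≠ 0 with hS
  set F : (Σ D : Finset κ, κ → D → ZMod 2) → Finset (κ → (ι → ZMod 2) × (μ → ZMod 2)) := fun q =>
    univ.filter fun p => (∀ j, (p j).2 = ∑ t, q.2 j t • (p t).2) ∧
      (fun j => (p j).1) ∈ constrainedFamilies ι q.1 q.2 i with hF
  have hsub : tensorRelations κ ι μ i ⊆ S.biUnion F := by
    intro p hp
    obtain ⟨D, c, h1, h2, h3, h4⟩ := exists_constraints_of_mem_tensorRelations hp
    rw [mem_biUnion]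
    refine ⟨⟨D, c⟩, ?_, ?_⟩
    · simp only [hS, mem_sigma, mem_univ, mem_filter, true_and]
      exact ⟨h1, h2⟩
    · simp only [hF, mem_filter, mem_univ, true_and]
      exact ⟨h3, h4⟩
  have hFcard : ∀ q, (F q).card ≤
      (2 ^ Fintype.card μ) ^ q.1.card * (constrainedFamilies ι q.1 q.2 i).card := by
    intro q
    have h1 : (univ : Finset (q.1 → μ → ZMod 2)).card = (2 ^ Fintype.card μ) ^ q.1.card := by
      rw [card_univ]; simp
    rw [← h1, ← card_product]
    refine card_le_card_of_injOn (fun p => (fun t => (p t).2, fun j => (p j).1)) ?_ ?_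
    · intro p hp
      simp only [hF, coe_filter, mem_univ, true_and, Set.mem_ofPred_eq] at hp
      simpa using hp.2
    · intro p hp p' hp' h
      simp only [hF, coe_filter, mem_univ, true_and, Set.mem_ofPred_eq] at hp hp'
      simp only [Prod.mk.injEq] at h
      funext j
      refine Prod.ext (congrFun h.2 j) ?_
      rw [hp.1 j, hp'.1 j]
      refine sum_congr rfl fun t _ => ?_
      rw [show (p t).2 = (p' t).2 from congrFun h.1 t]
  calc ((tensorRelations κ ι μ i).card : ℝ) ≤ ∑ q ∈ S, ((F q).card : ℝ) := by
        exact_mod_cast (card_le_card hsub).trans card_biUnion_le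
    -- The factor `(2 ^ d) ^ k` in `hB` pays for the coefficient matrices over a fixed `D`, so each
    -- `D` contributes at most `B` and only `2 ^ k` subsets remain.
    _ ≤ ∑ q ∈ S, B / (2 ^ q.1.card) ^ Fintype.card κ := by
        refine sum_le_sum fun q hq => ?_
        simp only [hS, mem_sigma, mem_univ, mem_filter, true_and] at hq
        obtain ⟨t, ht⟩ := exists_large_circuit hq.2
        have hd : 1 ≤ q.1.card := card_pos.2 ⟨t, t.2⟩
        have := hB _ _ _ hd (card_add_card_add_card_eq hq.1 t) ht
        rw [le_div_iff₀ (by positivity)]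
        refine le_trans ?_ this
        have h2 := (hFcard q).trans (Nat.mul_le_mul_left _ (card_constrainedFamilies_le (ι := ι) i hq.1 t))
        have h3 : ((F q).card : ℝ) ≤ ((2 : ℝ) ^ Fintype.card μ) ^ q.1.card *
          ((zeroSumFamilies (univ.filter fun j => q.2 j t ≠ 0 : Finset κ) ι i).card *
            ((layer ι i).card : ℝ) ^ (univ.filter fun j => j ∉ q.1 ∧ q.2 j t = 0).card) := by
          exact_mod_cast h2
        calc ((F q).card : ℝ) * (2 ^ q.1.card) ^ Fintype.card κ ≤ _ :=
              mul_le_mul_of_nonneg_right h3 (by positivity)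
          _ = _ := by ring
    _ ≤ ∑ q ∈ univ.sigma fun D : Finset κ => (univ : Finset (κ → D → ZMod 2)),
          B / (2 ^ q.1.card) ^ Fintype.card κ := by
        -- Nonnegativity of `B` is read off from `hB` at `d = 1`, `C = univ`, `e = 0`.
        have hBnn : 0 ≤ B := by
          obtain ⟨j⟩ := ‹Nonempty κ›
          have := hB univ 1 0 le_rfl (by rw [card_univ]; omega) (by rw [card_univ]; omega)
          exact le_trans (by positivity) this
        refine sum_le_sum_of_subset_of_nonneg ?_ fun q _ _ => by positivity
        exact sigma_mono (Subset.refl _) fun D => filter_subset _ _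
    _ = 2 ^ Fintype.card κ * B := by
        rw [sum_sigma]
        have : ∀ D : Finset κ, ∑ _c : κ → D → ZMod 2, B / ((2 : ℝ) ^ D.card) ^ Fintype.card κ = B := by
          intro D
          rw [sum_const, card_univ, nsmul_eq_mul]
          simp only [Fintype.card_fun, ZMod.card, Fintype.card_coe, Nat.cast_pow, Nat.cast_ofNat]
          field_simp
        rw [sum_congr rfl fun D _ => this D, sum_const, card_univ, nsmul_eq_mul]
        simp

end Relations

/-! ### The upper bound: rank one dominates -/

section UpperBound

lemma logb_one_add_le {x : ℝ} (hx : 0 ≤ x) : Real.logb 2 (1 + x) ≤ x / Real.log 2 := by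
  have l2 : 0 < Real.log 2 := Real.log_pos (by norm_num)
  rw [Real.logb]
  gcongr
  have := Real.log_le_sub_one_of_pos (x := 1 + x) (by positivity)
  linarith

/-- Since `h` is continuous with `h 0 = 0`, `ε ≤ h γ` keeps `γ` away from `0`. Hence `b₀` depends on
`ε` alone, as the constants of the theorem must. -/
lemma exists_forall_logb_one_add_pow_le {ε : ℝ} (hε : 0 < ε) :
    ∃ b₀ : ℕ, ∀ γ : ℝ, 0 < γ → γ < 1 / 2 → ε ≤ binaryEntropy γ → ∀ b : ℕ, b₀ ≤ b →
      Real.logb 2 (1 + (1 - 2 * γ) ^ b) ≤ ε := by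
  have l2 : 0 < Real.log 2 := Real.log_pos (by norm_num)
  have hcont : Continuous binaryEntropy := by
    have : binaryEntropy = fun t => Real.binEntropy t / Real.log 2 := funext binaryEntropy_eq_div
    rw [this]
    exact Real.binEntropy_continuous.div_const _
  have h0 : binaryEntropy 0 = 0 := by simp [binaryEntropy]
  obtain ⟨γ₀, hγ₀, hsmall⟩ := Metric.continuous_iff.1 hcont 0 ε hε
  set γ₁ := min γ₀ (1 / 4) with hγ₁
  have hpos : 0 < γ₁ := lt_min hγ₀ (by norm_num)
  have hle : γ₁ ≤ 1 / 4 := min_le_right _ _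
  obtain ⟨b₀, hb₀⟩ := exists_pow_lt_of_lt_one (mul_pos hε l2)
    (show 1 - 2 * γ₁ < 1 by linarith)
  refine ⟨b₀, fun γ h1 h2 h3 b hb => ?_⟩
  have hγ : γ₁ ≤ γ := by
    by_contra! hlt
    have := hsmall γ (by
      rw [Real.dist_eq, sub_zero, abs_of_pos h1]
      exact hlt.trans_le (min_le_left _ _))
    rw [Real.dist_eq, h0, sub_zero] at this
    exact absurd ((le_abs_self _).trans_lt this) (not_lt.2 h3)
  have hp : (1 - 2 * γ) ^ b ≤ ε * Real.log 2 :=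
    calc (1 - 2 * γ) ^ b ≤ (1 - 2 * γ₁) ^ b := pow_le_pow_left₀ (by linarith) (by linarith) b
      _ ≤ (1 - 2 * γ₁) ^ b₀ := pow_le_pow_of_le_one (by linarith) (by linarith) hb
      _ ≤ _ := hb₀.le
  refine (logb_one_add_le (pow_nonneg (by linarith) b)).trans ?_
  rwa [div_le_iff₀ l2]

lemma card_zeroSumFamilies_le_of_odds {κ ι : Type*} [Fintype κ] [Fintype ι] [DecidableEq κ]
    [DecidableEq ι] {γ : ℝ} (h0 : 0 < γ) (h1 : γ < 1 / 2) {i : ℕ}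
    (hi : (i : ℝ) = γ * Fintype.card ι) :
    ((zeroSumFamilies κ ι i).card : ℝ) ≤ 2 ^ ((Fintype.card κ * binaryEntropy γ - 1 +
      Real.logb 2 (1 + (1 - 2 * γ) ^ Fintype.card κ)) * Fintype.card ι) := by
  have h2 : 0 < 1 - γ := by linarith
  rw [← exponentAt_odds h0 h1]
  exact card_zeroSumFamilies_le_exponentAt (by positivity)
    (by rw [div_lt_one h2]; linarith) hi

theorem card_tensorRelations_le_two_rpow {ε γ lam : ℝ} {D₀ b₀ n m i k : ℕ} (hε : 0 < ε)
    (h0 : 0 < γ) (h1 : γ < 1 / 2) (hlam : lam + ε ≤ binaryEntropy γ)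
    (hD₀ : 4 / ε ≤ D₀) (hb₀ : ∀ b : ℕ, b₀ ≤ b → Real.logb 2 (1 + (1 - 2 * γ) ^ b) ≤ ε)
    (hn : 0 < n) (hi : (i : ℝ) = γ * n) (hm : (m : ℝ) = lam * n) (hk : 0 < k)
    (hkC : D₀ * b₀ ≤ k) (hkn : (k : ℝ) ≤ ε / 4 * n) :
    ((tensorRelations (Fin k) (Fin n) (Fin m) i).card : ℝ) ≤
      2 ^ k * (2 : ℝ) ^ ((D₀ : ℝ) * k + (momentExponent k γ * n + m)) := by
  have hn' : (0 : ℝ) < n := by exact_mod_cast hn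
  have hD1 : (0 : ℝ) < D₀ := lt_of_lt_of_le (by positivity) hD₀
  have hD1' : 1 ≤ D₀ := by exact_mod_cast hD1
  have : Nonempty (Fin k) := ⟨⟨0, hk⟩⟩
  have hF := mul_binaryEntropy_sub_one_le_momentExponent h0 (by linarith) k
  have hF' := mul_le_mul_of_nonneg_right hF hn'.le
  have hgap : (m : ℝ) + ε * n ≤ binaryEntropy γ * n := by
    rw [hm, ← add_mul]; exact mul_le_mul_of_nonneg_right hlam hn'.le
  have hL : ((layer (Fin n) i).card : ℝ) ≤ 2 ^ (binaryEntropy γ * n) := by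
    rw [card_layer, Fintype.card_fin]
    exact choose_le_two_rpow h0 (by linarith) hi
  have main := card_tensorRelations_le (κ := Fin k) (ι := Fin n) (μ := Fin m) (i := i)
    (B := (2 : ℝ) ^ ((D₀ : ℝ) * k + (momentExponent k γ * n + m))) ?_
  · simpa using main
  intro C d e hd hde hkd
  simp only [Fintype.card_fin] at hde hkd ⊢
  have hN := card_zeroSumFamilies_le_of_odds (κ := C) (ι := Fin n) h0 h1 (i := i) (by simpa using hi)
  simp only [Fintype.card_coe, Fintype.card_fin] at hN
  have hpre : ((2 : ℝ) ^ m) ^ d * (2 ^ d) ^ k = 2 ^ ((m : ℝ) * d + d * k) := by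
    rw [Real.rpow_add (by norm_num)]
    congr 1
    · rw [← pow_mul, ← Real.rpow_natCast]; push_cast; rfl
    · rw [← pow_mul, ← Real.rpow_natCast]; push_cast; rfl
  rw [hpre]
  -- Rank one is the main term: the relation involves all `k` words and no free word is left.
  rcases Nat.eq_or_lt_of_le hd with rfl | hd2
  · have hC : C.card = k := by omega
    have he : e = 0 := by omega
    have hN1 := card_zeroSumFamilies_le_momentExponent (κ := C) (ι := Fin n) (i := i)
      (γ := γ) (by simpa using hn) (by simpa using hi)
    simp only [Fintype.card_coe, Fintype.card_fin, hC] at hN1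
    rw [he, pow_zero, mul_one]
    calc _ ≤ (2 : ℝ) ^ ((m : ℝ) * (1 : ℕ) + (1 : ℕ) * k) * 2 ^ (momentExponent k γ * n) := by gcongr
      _ ≤ _ := by
        rw [← Real.rpow_add (by norm_num)]
        refine Real.rpow_le_rpow_of_exponent_le (by norm_num) ?_
        have : (1 : ℝ) * k ≤ D₀ * k := by gcongr; exact_mod_cast hD1'
        push_cast
        linarith
  · have he : (e : ℝ) = k + 1 - C.card - d := by
      have : (d : ℝ) + C.card + e = k + 1 := by exact_mod_cast hde
      linarith
    have hLe : ((layer (Fin n) i).card : ℝ) ^ e ≤ 2 ^ (binaryEntropy γ * n * e) := by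
      rw [Real.rpow_mul (by norm_num), Real.rpow_natCast]
      gcongr
    have hd2' : (2 : ℝ) ≤ d := by exact_mod_cast hd2
    refine (mul_le_mul_of_nonneg_left (mul_le_mul hN hLe (by positivity) (by positivity))
      (by positivity)).trans ?_
    rw [← Real.rpow_add (by norm_num), ← Real.rpow_add (by norm_num)]
    refine Real.rpow_le_rpow_of_exponent_le (by norm_num) ?_
    rw [he]
    have hg := mul_le_mul_of_nonneg_left hgap (show (0 : ℝ) ≤ d - 1 by linarith)
    have hεn : 0 < ε * n := by positivity
    -- For `d ≤ D₀` the circuit has at least `b₀` words, so one gain of `ε n` covers the logarithmic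
    -- term and `d k` goes into the error. For `d > D₀ ≥ 4 / ε` that term is at most `n`, and `n + d
    -- k ≤ n + d ε n / 4 ≤ d ε n / 2 ≤ (d - 1) ε n`.
    rcases le_or_gt d D₀ with hdD | hdD
    · have hb : b₀ ≤ C.card := by
        have : D₀ * b₀ ≤ D₀ * C.card := hkC.trans (hkd.trans (Nat.mul_le_mul_right _ hdD))
        exact Nat.le_of_mul_le_mul_left this hD1'
      have hη := mul_le_mul_of_nonneg_right (hb₀ _ hb) hn'.le
      have hdk : (d : ℝ) * k ≤ D₀ * k := by gcongr
      have : 1 * (ε * n) ≤ (d - 1) * (ε * n) := by gcongr; linarith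
      nlinarith
    · have hη : Real.logb 2 (1 + (1 - 2 * γ) ^ C.card) ≤ 1 := by
        have hx : (1 - 2 * γ) ^ C.card ≤ 1 := pow_le_one₀ (by linarith) (by linarith)
        have hx0 : 0 ≤ (1 - 2 * γ) ^ C.card := pow_nonneg (by linarith) _
        rw [Real.logb_le_iff_le_rpow (by norm_num) (by linarith), Real.rpow_one]
        linarith
      have hη' := mul_le_mul_of_nonneg_right hη hn'.le
      have hdD' : (4 : ℝ) / ε ≤ d := hD₀.trans (by exact_mod_cast hdD.le)
      have hdε : 4 ≤ d * ε := by rwa [div_le_iff₀ hε] at hdD'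
      have hdε' := mul_le_mul_of_nonneg_right hdε hn'.le
      have hdk : (d : ℝ) * k ≤ d * (ε / 4 * n) := by gcongr
      have hDk : 0 ≤ (D₀ : ℝ) * k := by positivity
      have : (d : ℝ) / 2 * (ε * n) ≤ (d - 1) * (ε * n) := by gcongr; linarith
      nlinarith

end UpperBound

/-! ### Zero-sum families with prescribed weights -/

section Filling

variable {ρ : Type*} [Fintype ρ] [DecidableEq ρ]

/-- Three weights are those of `y`, `x`, `y + x` once they satisfy the triangle inequalities, have
even total and fit in the ground set. -/
lemma exists_hammingNorm_add_eq (y : ρ → ZMod 2) {d w' : ℕ} (h1 : w' ≤ hammingNorm y + d)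
    (h2 : hammingNorm y ≤ w' + d) (h3 : d ≤ w' + hammingNorm y)
    (h4 : hammingNorm y + d + w' ≤ 2 * Fintype.card ρ) (h5 : Even (hammingNorm y + d + w')) :
    ∃ x : ρ → ZMod 2, hammingNorm x = d ∧ hammingNorm (y + x) = w' := by
  set S : Finset ρ := univ.filter fun r => y r ≠ 0 with hS
  have hSc : hammingNorm y = S.card := rfl
  have hSc' : Sᶜ.card = Fintype.card ρ - S.card := card_compl S
  obtain ⟨e, he⟩ := h5
  rw [hSc] at h1 h2 h3 h4 he
  -- With `e` half the perimeter, `x` must meet the support of `y` in `S.card + d - e` places and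
  -- its complement in `e - S.card`.
  obtain ⟨A, hAS, hA⟩ := exists_subset_card_eq (s := S) (n := S.card + d - e) (by omega)
  obtain ⟨B, hBS, hB⟩ := exists_subset_card_eq (s := Sᶜ) (n := e - S.card) (by
    rw [hSc']; omega)
  have hAB : Disjoint A B := disjoint_of_subset_left hAS
    (disjoint_of_subset_right hBS disjoint_compl_right)
  have hy : ∀ r, y r = if r ∈ S then 1 else 0 := by
    intro r
    rcases zmod_two_eq (y r) with h | h <;> simp [hS, h]
  refine ⟨fun r => if r ∈ A ∪ B then 1 else 0, ?_, ?_⟩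
  · have : ∀ T : Finset ρ, hammingNorm (fun r => if r ∈ T then (1 : ZMod 2) else 0) = T.card := by
      intro T; simp [hammingNorm]
    rw [this, card_union_of_disjoint hAB]
    omega
  · have h6 : (univ.filter fun r => (y + fun r => if r ∈ A ∪ B then (1 : ZMod 2) else 0) r ≠ 0) =
        (S \ A) ∪ B := by
      ext r
      simp only [mem_filter, mem_univ, true_and, Pi.add_apply, hy r, mem_union, mem_sdiff]
      by_cases hrS : r ∈ S
      · have hrB : r ∉ B := fun h => (mem_compl.1 (hBS h)) hrS
        by_cases hrA : r ∈ A <;> simp [hrS, hrA, hrB, show (1 : ZMod 2) + 1 = 0 from by decide]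
      · have hrA : r ∉ A := fun h => hrS (hAS h)
        by_cases hrB : r ∈ B <;> simp [hrS, hrA, hrB]
    have h7 : Disjoint (S \ A) B := disjoint_of_subset_left sdiff_subset
      (disjoint_of_subset_right hBS disjoint_compl_right)
    rw [hammingNorm, h6, card_union_of_disjoint h7, card_sdiff_of_subset hAS]
    omega

/-- Greedy choice: parity decides whether the next partial sum has weight `b` or `b + 1`, and from
either one every weight in `[a, b]` allows another step. -/
lemma exists_partial_sums {a b : ℕ} (hab : b + 1 ≤ 2 * a) (hbr : 3 * b + 2 ≤ 2 * Fintype.card ρ)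
    {d : ℕ → ℕ} (hd : ∀ j, a ≤ d j ∧ d j ≤ b) (s : ℕ) :
    ∃ x : ℕ → ρ → ZMod 2, (∀ j < s + 2, hammingNorm (x j) = d j) ∧
      Even (hammingNorm (∑ j ∈ range (s + 2), x j) + ∑ j ∈ range (s + 2), d j) ∧
      b ≤ hammingNorm (∑ j ∈ range (s + 2), x j) ∧
      hammingNorm (∑ j ∈ range (s + 2), x j) ≤ b + 1 := by
  have step : ∀ (y : ρ → ZMod 2) (d' : ℕ), a ≤ d' → d' ≤ b → b + 1 ≤ hammingNorm y + d' →
      hammingNorm y ≤ b + d' → d' ≤ b + hammingNorm y → hammingNorm y + d' ≤ 2 * b + 1 →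
      ∃ x : ρ → ZMod 2, hammingNorm x = d' ∧ Even (hammingNorm (y + x) + (hammingNorm y + d')) ∧
        b ≤ hammingNorm (y + x) ∧ hammingNorm (y + x) ≤ b + 1 := by
    intro y d' h1 h2 h3 h4 h5 h6
    rcases Nat.even_or_odd (hammingNorm y + d' + b) with he | ho
    · obtain ⟨x, hx, hyx⟩ := exists_hammingNorm_add_eq y (d := d') (w' := b)
        (by omega) (by omega) (by omega) (by omega) he
      refine ⟨x, hx, ?_, by omega, by omega⟩
      rw [hyx, add_comm]; exact he
    · obtain ⟨x, hx, hyx⟩ := exists_hammingNorm_add_eq y (d := d') (w' := b + 1)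
        (by omega) (by omega) (by omega) (by omega) ho.add_one
      refine ⟨x, hx, ?_, by omega, by omega⟩
      rw [hyx, add_comm]; exact ho.add_one
  induction s with
  | zero =>
    obtain ⟨x₀, hx₀, -⟩ := exists_hammingNorm_add_eq (0 : ρ → ZMod 2) (d := d 0) (w' := d 0)
      (by omega) (by simp) (by omega)
      (by rw [hammingNorm_zero]; have := hd 0; omega) (by rw [hammingNorm_zero]; exact ⟨d 0, by omega⟩)
    have h0 := hd 0
    have h1 := hd 1
    obtain ⟨x₁, hx₁, he, hl, hu⟩ := step x₀ (d 1) h1.1 h1.2 (by omega) (by omega) (by omega) (by omega)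
    refine ⟨fun j => if j = 0 then x₀ else x₁, ?_, ?_, ?_, ?_⟩
    · intro j hj
      interval_cases j <;> simp [hx₀, hx₁]
    · simp only [sum_range_succ, range_zero, sum_empty, zero_add]
      simpa [hx₀] using he
    · simpa [sum_range_succ] using hl
    · simpa [sum_range_succ] using hu
  | succ s ih =>
    obtain ⟨x, hx, hev, hlow, hup⟩ := ih
    have h1 := hd (s + 2)
    obtain ⟨z, hz, he, hl, hu⟩ := step (∑ j ∈ range (s + 2), x j) (d (s + 2)) h1.1 h1.2
      (by omega) (by omega) (by omega) (by omega)
    have hs : ∑ j ∈ range (s + 1 + 2), (if j < s + 2 then x j else z) =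
        ∑ j ∈ range (s + 2), x j + z := by
      rw [show s + 1 + 2 = s + 2 + 1 by ring, sum_range_succ]
      congr 1
      · exact sum_congr rfl fun j hj => if_pos (mem_range.1 hj)
      · simp
    refine ⟨fun j => if j < s + 2 then x j else z, ?_, ?_, ?_, ?_⟩
    · intro j hj
      by_cases hjs : j < s + 2
      · simp only [hjs, if_true]; exact hx j hjs
      · have : j = s + 2 := by omega
        subst this
        simpa using hz
    · have hsd : ∑ j ∈ range (s + 1 + 2), d j = ∑ j ∈ range (s + 2), d j + d (s + 2) :=
        sum_range_succ _ _
      rw [hs, hsd]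
      rw [Nat.even_iff] at he hev ⊢
      omega
    · rw [hs]; exact hl
    · rw [hs]; exact hu

lemma exists_zero_sum_of_hammingNorm {a b k : ℕ} (hab : b + 1 ≤ 2 * a)
    (hbr : 3 * b + 2 ≤ 2 * Fintype.card ρ) (hk : 4 ≤ k) {d : Fin k → ℕ}
    (hd : ∀ j, a ≤ d j ∧ d j ≤ b) (hev : Even (∑ j, d j)) :
    ∃ x : Fin k → ρ → ZMod 2, (∀ j, hammingNorm (x j) = d j) ∧ ∑ j, x j = 0 := by
  obtain ⟨s, rfl⟩ : ∃ s, k = s + 4 := ⟨k - 4, by omega⟩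
  -- The value `a` past the end merely keeps `d'` within `[a, b]`.
  set d' : ℕ → ℕ := fun j => if h : j < s + 4 then d ⟨j, h⟩ else a with hd'
  have hd'b : ∀ j, a ≤ d' j ∧ d' j ≤ b := by
    intro j
    simp only [hd']
    split_ifs with h
    · exact hd _
    · have := hd ⟨0, by omega⟩
      omega
  have hsum : ∑ j, d j = ∑ j ∈ range (s + 4), d' j := by
    rw [← Fin.sum_univ_eq_sum_range]
    refine sum_congr rfl fun j _ => ?_
    simp [hd']
  have hlast : ∑ j ∈ range (s + 4), d' j =
      ∑ j ∈ range (s + 2), d' j + d' (s + 2) + d' (s + 2 + 1) := by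
    rw [show s + 4 = s + 2 + 1 + 1 by ring, sum_range_succ _ (s + 2 + 1), sum_range_succ _ (s + 2)]
  rw [hsum, hlast] at hev
  obtain ⟨x, hx, he, hl, hu⟩ := exists_partial_sums (ρ := ρ) hab hbr hd'b s
  set y := ∑ j ∈ range (s + 2), x j with hy
  have h2 := hd'b (s + 2)
  have h3 := hd'b (s + 2 + 1)
  -- The last two words close a triangle with the partial sum `y`; `hab` gives its triangle
  -- inequality and the even total its parity.
  obtain ⟨z, hz, hyz⟩ := exists_hammingNorm_add_eq y (d := d' (s + 2)) (w' := d' (s + 2 + 1))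
    (by omega) (by omega) (by omega) (by omega) (by
      rw [Nat.even_iff] at he hev ⊢
      omega)
  set X : ℕ → ρ → ZMod 2 := fun j => if j < s + 2 then x j else if j = s + 2 then z else y + z
    with hX
  refine ⟨fun j => X j, ?_, ?_⟩
  · intro j
    have hdj : d j = d' j := by simp [hd']
    rw [hdj]
    by_cases h : (j : ℕ) < s + 2
    · simp only [hX, h, if_true]; exact hx j h
    · by_cases h' : (j : ℕ) = s + 2
      · simp only [hX, h', lt_irrefl, if_false, if_true]; exact hz
      · have : (j : ℕ) = s + 2 + 1 := by omega
        simp only [hX, h, h', if_false]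
        rw [hyz, this]
  · rw [Fin.sum_univ_eq_sum_range X (s + 4), show s + 4 = s + 2 + 1 + 1 by ring, sum_range_succ,
      sum_range_succ]
    have e1 : ∑ j ∈ range (s + 2), X j = y := by
      rw [hy]
      exact sum_congr rfl fun j hj => if_pos (mem_range.1 hj)
    have e2 : X (s + 2) = z := by simp [hX]
    have e3 : X (s + 2 + 1) = y + z := by simp [hX]
    rw [e1, e2, e3]
    ext r
    exact CharTwo.add_self_eq_zero ((y + z) r)

end Filling

/-! ### A second moment bound for product weights -/

section Chebyshev

/-- Unnormalised variance of a sum of independent centred variables: `hmean` kills the cross terms.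
-/
lemma sum_prod_mul_sq_sum_le {R : Type*} [Fintype R] {w φ : R → ℝ} (hw : ∀ v, 0 ≤ w v)
    (hφ : ∀ v, φ v ^ 2 ≤ 1) (hmean : ∑ v, w v * φ v = 0) (n : ℕ) :
    ∑ Z : Fin n → R, (∏ r, w (Z r)) * (∑ r, φ (Z r)) ^ 2 ≤ n * (∑ v, w v) ^ n := by
  induction n with
  | zero => simp
  | succ n ih =>
    rw [← (Fin.consEquiv fun _ => R).sum_comp, Fintype.sum_prod_type]
    simp only [Fin.consEquiv_apply, Fin.prod_univ_succ, Fin.sum_univ_succ, Fin.cons_zero,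
      Fin.cons_succ]
    have htot : ∑ Z : Fin n → R, ∏ r, w (Z r) = (∑ v, w v) ^ n := by
      rw [← Fintype.prod_sum (fun (_ : Fin n) v => w v)]; simp
    have hP : 0 ≤ ∑ v, w v := sum_nonneg fun v _ => hw v
    have hsq : ∑ v, w v * φ v ^ 2 ≤ ∑ v, w v :=
      sum_le_sum fun v _ => mul_le_of_le_one_right (hw v) (hφ v)
    have expand : ∑ v, ∑ Z : Fin n → R, (w v * ∏ r, w (Z r)) * (φ v + ∑ r, φ (Z r)) ^ 2 =
        (∑ v, w v * φ v ^ 2) * ∑ Z : Fin n → R, ∏ r, w (Z r) +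
        2 * ((∑ v, w v * φ v) * ∑ Z : Fin n → R, (∏ r, w (Z r)) * ∑ r, φ (Z r)) +
        (∑ v, w v) * ∑ Z : Fin n → R, (∏ r, w (Z r)) * (∑ r, φ (Z r)) ^ 2 := by
      simp only [sum_mul_sum, mul_sum (a := (2 : ℝ)), ← sum_add_distrib]
      refine sum_congr rfl fun v _ => sum_congr rfl fun Z _ => ?_
      ring
    rw [expand, hmean, htot]
    have h1 := mul_le_mul_of_nonneg_right hsq (pow_nonneg hP n)
    have h2 := mul_le_mul_of_nonneg_left ih hP
    push_cast
    rw [pow_succ]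
    nlinarith

end Chebyshev

/-! ### Typical families under the tilted measure -/

section Profile

lemma cast_hammingNorm_eq_sum {ι : Type*} [Fintype ι] (y : ι → ZMod 2) :
    (hammingNorm y : ℝ) = ∑ r, if y r = 0 then 0 else 1 := by
  rw [hammingNorm, card_filter, Nat.cast_sum]
  refine sum_congr rfl fun r _ => ?_
  split_ifs <;> simp_all

/-- Chebyshev with a union bound over the `k` words: the total failure probability is at most `k n /
t ^ 2 ≤ 1 / 2`. -/
lemma half_evenMass_pow_le_sum_typical {α γ t : ℝ} {n k : ℕ} (hα : 0 ≤ α) (hγ0 : 0 ≤ γ)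
    (hγ1 : γ ≤ 1) (ht : 0 < t) (htn : 2 * k * n ≤ t ^ 2)
    (hmean : α * ((1 + α) ^ (k - 1) - (1 - α) ^ (k - 1)) / 2 = γ * evenMass α k)
    (hpos : 0 ≤ evenMass α k) :
    evenMass α k ^ n / 2 ≤
      ∑ Z ∈ univ.filter fun Z : Fin n → Fin k → ZMod 2 =>
        ∀ j, |(hammingNorm fun r => Z r j : ℝ) - γ * n| ≤ t, ∏ r, evenWeight α (Z r) := by
  classical
  set W : (Fin n → Fin k → ZMod 2) → ℝ := fun Z => ∏ r, evenWeight α (Z r) with hW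
  have hW0 : ∀ Z, 0 ≤ W Z := fun Z => prod_nonneg fun r _ => evenWeight_nonneg hα _
  have htot : ∑ Z, W Z = evenMass α k ^ n := by
    simpa using sum_prod_evenWeight (κ := Fin k) (ι := Fin n) α
  have hvar : ∀ j : Fin k, ∑ Z, W Z * ((hammingNorm fun r => Z r j : ℝ) - γ * n) ^ 2 ≤
      n * evenMass α k ^ n := by
    intro j
    have h := sum_prod_mul_sq_sum_le (w := evenWeight (κ := Fin k) α)
      (φ := fun v => (if v j = 0 then 0 else 1) - γ) (evenWeight_nonneg hα) ?_ ?_ n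
    · rw [sum_evenWeight, Fintype.card_fin] at h
      refine le_trans (le_of_eq (sum_congr rfl fun Z _ => ?_)) h
      rw [cast_hammingNorm_eq_sum, sum_sub_distrib]
      simp [mul_comm, hW]
    · intro v
      split_ifs
      · nlinarith
      · nlinarith
    · simp only [mul_sub, sum_sub_distrib]
      rw [sum_evenWeight_mul_indicator, ← sum_mul, sum_evenWeight, Fintype.card_fin, hmean]
      ring
  have hpt : ∀ Z, W Z * t ^ 2 ≤ (if ∀ j, |(hammingNorm fun r => Z r j : ℝ) - γ * n| ≤ t then W Z else 0)
      * t ^ 2 + ∑ j, W Z * ((hammingNorm fun r => Z r j : ℝ) - γ * n) ^ 2 := by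
    intro Z
    have hnn : ∀ j ∈ (univ : Finset (Fin k)),
        0 ≤ W Z * ((hammingNorm fun r => Z r j : ℝ) - γ * n) ^ 2 := fun j _ =>
      mul_nonneg (hW0 Z) (sq_nonneg _)
    split_ifs with h
    · have := sum_nonneg hnn
      linarith
    · push Not at h
      obtain ⟨j, hj⟩ := h
      have h1 := single_le_sum hnn (mem_univ j)
      have h2 : t ^ 2 ≤ ((hammingNorm fun r => Z r j : ℝ) - γ * n) ^ 2 := by
        rw [← sq_abs ((hammingNorm fun r => Z r j : ℝ) - γ * n)]
        exact pow_le_pow_left₀ ht.le hj.le 2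
      have h3 := mul_le_mul_of_nonneg_left h2 (hW0 Z)
      linarith
  have hsum := sum_le_sum fun Z (_ : Z ∈ univ) => hpt Z
  rw [← sum_mul, htot, sum_add_distrib, ← sum_mul, ← sum_filter, sum_comm] at hsum
  have h4 := sum_le_sum fun j (_ : j ∈ (univ : Finset (Fin k))) => hvar j
  rw [sum_const, card_univ, Fintype.card_fin, nsmul_eq_mul] at h4
  have h5 : (k : ℝ) * (n * evenMass α k ^ n) ≤ t ^ 2 / 2 * evenMass α k ^ n := by
    have := mul_le_mul_of_nonneg_right htn (pow_nonneg hpos n)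
    linarith
  have ht2 : 0 < t ^ 2 := by positivity
  refine le_of_mul_le_mul_right ?_ ht2
  linarith

/-- Each typical array of even vectors on `n` coordinates leaves every word a deficit in `[a, b]`,
which is filled exactly on `r` new coordinates. The map is injective because the first `n`
coordinates are retained. -/
theorem half_evenMass_pow_le_card_zeroSumFamilies {α γ t : ℝ} {n r i k a b : ℕ} (hα : 0 < α)
    (hα1 : α < 1) (hγ0 : 0 ≤ γ) (hγ1 : γ ≤ 1) (ht : 0 < t) (htn : 2 * k * n ≤ t ^ 2)
    (hmean : α * ((1 + α) ^ (k - 1) - (1 - α) ^ (k - 1)) / 2 = γ * evenMass α k)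
    (hk : 4 ≤ k) (hi : (i : ℝ) = γ * (n + r)) (hie : Even i) (ha : (a : ℝ) ≤ γ * r - t)
    (hb : γ * r + t ≤ b) (hab : b + 1 ≤ 2 * a) (hbr : 3 * b + 2 ≤ 2 * r) :
    evenMass α k ^ n / 2 ≤
      (zeroSumFamilies (Fin k) (Fin (n + r)) i).card * α ^ (k * (i - b)) := by
  classical
  rw [card_zeroSumFamilies_congr (finSumFinEquiv (m := n) (n := r)).symm]
  set S := univ.filter fun Z : Fin n → Fin k → ZMod 2 =>
        ∀ j, |(hammingNorm fun r => Z r j : ℝ) - γ * n| ≤ t with hS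
  set S' := S.filter fun Z => ∀ r, ∑ j, Z r j = 0 with hS'
  have hbase := half_evenMass_pow_le_sum_typical hα.le hγ0 hγ1 ht htn hmean
    (evenMass_pos hα hα1 k).le
  rw [← hS] at hbase
  have hdev : ∀ Z ∈ S, ∀ j, (hammingNorm fun r => Z r j) ≤ i ∧
      a ≤ i - (hammingNorm fun r => Z r j) ∧ i - (hammingNorm fun r => Z r j) ≤ b := by
    intro Z hZ j
    rw [hS, mem_filter] at hZ
    have h1 := abs_le.1 (hZ.2 j)
    have h2 : (a : ℝ) + (hammingNorm fun r => Z r j) ≤ i := by rw [hi]; linarith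
    have h3 : (i : ℝ) ≤ b + (hammingNorm fun r => Z r j) := by rw [hi]; linarith
    have h2' : a + (hammingNorm fun r => Z r j) ≤ i := by exact_mod_cast h2
    have h3' : i ≤ b + (hammingNorm fun r => Z r j) := by exact_mod_cast h3
    omega
  have hrow : ∀ Z ∈ S', ∑ j, (fun r => Z r j) = (0 : Fin n → ZMod 2) := by
    intro Z hZ
    rw [hS', mem_filter] at hZ
    ext r
    rw [Finset.sum_apply]
    exact hZ.2 r
  have hfill : ∀ Z ∈ S', ∃ y : Fin k → Fin r → ZMod 2,
      (∀ j, hammingNorm (y j) = i - hammingNorm fun r => Z r j) ∧ ∑ j, y j = 0 := by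
    intro Z hZ
    have hZS : Z ∈ S := (mem_filter.1 hZ).1
    refine exists_zero_sum_of_hammingNorm hab (by simpa using hbr) hk
      (fun j => (hdev Z hZS j).2) ?_
    -- Every coordinate is an even vector, so the weights have even total; with `k * i` even, so do
    -- the deficits.
    have hZe : Even (∑ j, hammingNorm fun r => Z r j) := by
      have e1 : ∑ j, (hammingNorm fun r => Z r j) = ∑ r, hammingNorm (Z r) := by
        simp only [hammingNorm, card_filter]
        rw [sum_comm]
      rw [e1]
      refine even_sum _ fun r _ => ?_
      have e2 := (mem_filter.1 hZ).2 r
      have e3 : ((hammingNorm (Z r) : ℕ) : ZMod 2) = ∑ j, Z r j := by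
        rw [hammingNorm, card_filter, Nat.cast_sum]
        refine sum_congr rfl fun j _ => ?_
        rcases zmod_two_eq (Z r j) with h | h <;> simp [h]
      rw [e2, ZMod.natCast_eq_zero_iff] at e3
      exact even_iff_two_dvd.2 e3
    have hadd : ∑ j, (i - hammingNorm fun r => Z r j) + ∑ j, (hammingNorm fun r => Z r j) = k * i := by
      rw [← sum_add_distrib, sum_congr rfl fun j _ => Nat.sub_add_cancel (hdev Z hZS j).1]
      simp
    have hki : Even (k * i) := hie.mul_left k
    rw [← hadd, Nat.even_add] at hki
    exact hki.2 hZe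
  choose! Y hY1 hY2 using hfill
  have hcard : S'.card ≤ (zeroSumFamilies (Fin k) (Fin n ⊕ Fin r) i).card := by
    refine card_le_card_of_injOn (fun Z j => Sum.elim (fun l => Z l j) (Y Z j)) ?_ ?_
    · intro Z hZ
      rw [mem_coe] at hZ
      rw [mem_coe, mem_zeroSumFamilies]
      constructor
      · intro j
        have e1 : hammingNorm (Sum.elim (fun l => Z l j) (Y Z j)) =
            (hammingNorm fun l => Z l j) + hammingNorm (Y Z j) := by
          simp only [hammingNorm, card_filter, Fintype.sum_sum_type]
          rfl
        rw [e1, hY1 Z hZ]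
        have := (hdev Z (mem_filter.1 hZ).1 j).1
        omega
      · ext l
        rw [Finset.sum_apply]
        rcases l with l | l
        · simpa using congrFun (hrow Z hZ) l
        · simpa using congrFun (hY2 Z hZ) l
    · intro Z _ Z' _ h
      ext l j
      exact congrFun (congrFun h j) (Sum.inl l)
  have hwt : ∑ Z ∈ S, ∏ r, evenWeight α (Z r) ≤ S'.card * α ^ (k * (i - b)) := by
    have e1 : ∑ Z ∈ S, ∏ r, evenWeight α (Z r) = ∑ Z ∈ S', ∏ r, evenWeight α (Z r) := by
      rw [hS', sum_filter (s := S)]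
      refine sum_congr rfl fun Z _ => ?_
      split_ifs with h
      · rfl
      · push Not at h
        obtain ⟨r, hr⟩ := h
        exact prod_eq_zero (mem_univ r) (if_neg hr)
    rw [e1, ← nsmul_eq_mul, ← sum_const]
    refine sum_le_sum fun Z hZ => ?_
    rw [prod_evenWeight_transpose α (x := fun j r => Z r j) (hrow Z hZ)]
    refine pow_le_pow_of_le_one hα.le hα1.le ?_
    calc k * (i - b) = ∑ _j : Fin k, (i - b) := by simp
      _ ≤ _ := sum_le_sum fun j _ => by
        have := hdev Z (mem_filter.1 hZ).1 j
        omega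
  refine hbase.trans (hwt.trans ?_)
  gcongr

/-- The intermediate value theorem yields a tilt with mean `γ`. The bound `γ ≤ α` holds because the
left side is at most `α` times the mass; it controls powers of `α` later. -/
lemma exists_tilt {γ : ℝ} (h0 : 0 < γ) (h1 : γ < 1 / 2) {k : ℕ} (hk : 2 ≤ k) :
    ∃ α : ℝ, γ ≤ α ∧ α < 1 ∧
      α * ((1 + α) ^ (k - 1) - (1 - α) ^ (k - 1)) / 2 = γ * evenMass α k := by
  obtain ⟨l, rfl⟩ : ∃ l, k = l + 1 := ⟨k - 1, by omega⟩
  simp only [Nat.add_sub_cancel]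
  set f : ℝ → ℝ := fun α => α * ((1 + α) ^ l - (1 - α) ^ l) / 2 - γ * evenMass α (l + 1) with hf
  have hcont : Continuous f := by
    simp only [hf, evenMass]; fun_prop
  have hf0 : f 0 < 0 := by simp [hf, evenMass]; linarith
  have hf1 : 0 < f 1 := by
    have hl : l ≠ 0 := by omega
    have : (0 : ℝ) < 2 ^ l := by positivity
    simp only [hf, evenMass, sub_self, zero_pow hl, pow_succ,
      one_add_one_eq_two]
    nlinarith
  obtain ⟨α, ⟨ha0, ha1⟩, hα⟩ := intermediate_value_Ioo (by norm_num : (0 : ℝ) ≤ 1)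
    hcont.continuousOn ⟨hf0, hf1⟩
  have heq : α * ((1 + α) ^ l - (1 - α) ^ l) / 2 = γ * evenMass α (l + 1) := by
    simpa [hf, sub_eq_zero] using hα
  refine ⟨α, ?_, ha1, heq⟩
  have hpos := evenMass_pos ha0 ha1 (l + 1)
  refine le_of_mul_le_mul_right ?_ hpos
  rw [← heq, evenMass]
  have : 0 < 1 - α := by linarith
  have e1 : (1 + α) ^ l ≤ (1 + α) ^ (l + 1) := pow_le_pow_right₀ (by linarith) (by omega)
  have e2 : 0 ≤ (1 - α) ^ l := by positivity
  have e3 : 0 ≤ (1 - α) ^ (l + 1) := by positivity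
  nlinarith

end Profile

/-! ### Lower bound for `k ^ 3` small compared with `n` -/

section SmallLowerBound

/-- Only `F ≤ exponentAt k γ α` is used, so the tilt need not be shown to be the minimiser. The last
factor is the price of the `r` correcting coordinates. -/
lemma two_rpow_momentExponent_le_card_mul {γ t : ℝ} {n r i k a b : ℕ} (h0 : 0 < γ) (h1 : γ < 1 / 2)
    (ht : 0 < t) (htn : 2 * k * n ≤ t ^ 2) (hk : 4 ≤ k) (hi : (i : ℝ) = γ * (n + r)) (hie : Even i)
    (ha : (a : ℝ) ≤ γ * r - t) (hb : γ * r + t ≤ b) (hab : b + 1 ≤ 2 * a)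
    (hbr : 3 * b + 2 ≤ 2 * r) :
    (2 : ℝ) ^ (momentExponent k γ * (n + r : ℕ)) ≤
      (zeroSumFamilies (Fin k) (Fin (n + r)) i).card * (2 * (2 / γ) ^ (k * r)) := by
  obtain ⟨α, hγα, hα1, hmean⟩ := exists_tilt h0 h1 (show 2 ≤ k by omega)
  have hα : 0 < α := h0.trans_le hγα
  have main := half_evenMass_pow_le_card_zeroSumFamilies hα hα1 h0.le (by linarith) ht htn hmean hk
    hi hie ha hb hab hbr
  set N : ℝ := ((zeroSumFamilies (Fin k) (Fin (n + r)) i).card : ℝ) with hN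
  have hN0 : 0 ≤ N := Nat.cast_nonneg _
  have hG : evenMass α k ≤ 2 ^ k := by
    have e1 : (1 + α) ^ k ≤ 2 ^ k := pow_le_pow_left₀ (by linarith) (by linarith) k
    have e2 : (1 - α) ^ k ≤ 2 ^ k := pow_le_pow_left₀ (by linarith) (by linarith) k
    unfold evenMass; linarith
  have hGp := evenMass_pos hα hα1 k
  have hGr : evenMass α k ^ r ≤ 2 ^ (k * r) := by
    rw [pow_mul]; exact pow_le_pow_left₀ hGp.le hG r
  have hexp := two_rpow_exponentAt_mul hα hα1 k (n := n + r) (i := i) (γ := γ) (by push_cast; exact hi)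
  have hF : (2 : ℝ) ^ (momentExponent k γ * (n + r : ℕ)) ≤ 2 ^ (exponentAt k γ α * (n + r : ℕ)) := by
    refine Real.rpow_le_rpow_of_exponent_le (by norm_num) ?_
    exact mul_le_mul_of_nonneg_right (momentExponent_le h0 (by linarith) hα hα1 k) (Nat.cast_nonneg _)
  have hsplit : α ^ (k * (i - b)) * α ^ (k * b) ≤ α ^ (k * i) := by
    rw [← pow_add, ← mul_add]
    exact pow_le_pow_of_le_one hα.le hα1.le (Nat.mul_le_mul_left _ (by omega))
  have hlow : γ ^ (k * r) ≤ α ^ (k * b) :=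
    calc γ ^ (k * r) ≤ α ^ (k * r) := pow_le_pow_left₀ h0.le hγα _
      _ ≤ _ := pow_le_pow_of_le_one hα.le hα1.le (Nat.mul_le_mul_left _ (by omega))
  have key : (2 : ℝ) ^ (exponentAt k γ α * (n + r : ℕ)) * γ ^ (k * r) ≤ N * (2 * 2 ^ (k * r)) := by
    refine le_of_mul_le_mul_right ?_ (show 0 < α ^ (k * i) by positivity)
    calc (2 : ℝ) ^ (exponentAt k γ α * (n + r : ℕ)) * γ ^ (k * r) * α ^ (k * i)
        = evenMass α k ^ n * evenMass α k ^ r * γ ^ (k * r) := by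
          rw [← pow_add, ← hexp]; ring
      _ ≤ (2 * (N * α ^ (k * (i - b)))) * 2 ^ (k * r) * α ^ (k * b) := by
          gcongr
          linarith
      _ = N * (2 * 2 ^ (k * r)) * (α ^ (k * (i - b)) * α ^ (k * b)) := by ring
      _ ≤ N * (2 * 2 ^ (k * r)) * α ^ (k * i) := by gcongr
  rw [div_pow]
  have hγp : 0 < γ ^ (k * r) := by positivity
  calc (2 : ℝ) ^ (momentExponent k γ * (n + r : ℕ)) ≤ 2 ^ (exponentAt k γ α * (n + r : ℕ)) := hF
    _ ≤ N * (2 * 2 ^ (k * r)) / γ ^ (k * r) := by rwa [le_div_iff₀ hγp]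
    _ = _ := by ring

theorem exists_lower_bound_of_pow_three_le {γ δ : ℝ} (h0 : 0 < γ) (h1 : γ < 1 / 2) (hδ : 0 < δ) :
    ∃ η : ℝ, 0 < η ∧ ∃ n₀ : ℕ, ∀ n i k : ℕ, n₀ ≤ n → 4 ≤ k → (k : ℝ) ^ 3 ≤ η * n →
      (i : ℝ) = γ * n → Even i →
      (2 : ℝ) ^ (momentExponent k γ * n - δ * n) ≤ (zeroSumFamilies (Fin k) (Fin n) i).card := by
  set Lg : ℝ := Real.logb 2 (2 / γ) with hLg
  have hLgpos : 0 < Lg := Real.logb_pos (by norm_num) (by rw [lt_div_iff₀ h0]; linarith)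
  -- The first bound makes `r ≤ n`; the second makes the price `(2 / γ) ^ (k r)` at most `2 ^ (δ n /
  -- 2)`, as `γ r ≤ 11 t` and `t k ≤ σ n`.
  set σ : ℝ := min (γ / 11) (γ * δ / (22 * Lg)) with hσ
  have hσ0 : 0 < σ := lt_min (by positivity) (by positivity)
  have hσ1 : 11 * σ ≤ γ := by
    have := min_le_left (γ / 11) (γ * δ / (22 * Lg))
    linarith
  have hσ2 : 11 * σ * Lg ≤ γ * (δ / 2) := by
    have := min_le_right (γ / 11) (γ * δ / (22 * Lg))
    rw [← hσ, le_div_iff₀ (by positivity)] at this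
    linarith
  obtain ⟨n₀, hn₀⟩ := exists_nat_ge (2 / δ)
  refine ⟨σ ^ 2 / 2, by positivity, max n₀ 1, fun n i k hn hk hk3 hi hie => ?_⟩
  have hn1 : 1 ≤ n := (le_max_right _ _).trans hn
  have hn1' : (1 : ℝ) ≤ n := by exact_mod_cast hn1
  have hnδ : 2 / δ ≤ n := hn₀.trans (by exact_mod_cast (le_max_left _ _).trans hn)
  rw [div_le_iff₀ hδ] at hnδ
  have hk' : (4 : ℝ) ≤ k := by exact_mod_cast hk
  set t : ℝ := Real.sqrt (2 * k * n) with ht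
  have htsq : t ^ 2 = 2 * k * n := Real.sq_sqrt (by positivity)
  have ht1 : 1 ≤ t := by
    rw [ht]; refine Real.one_le_sqrt.2 ?_; nlinarith
  -- Here `k ^ 3 ≤ η n` is needed: the price exponent is of order `k t`, that is `k √(k n)`.
  have htk : t * k ≤ σ * n := by
    refine le_of_sq_le_sq ?_ (by positivity)
    calc (t * k) ^ 2 = 2 * (k ^ 3) * n := by rw [mul_pow, htsq]; ring
      _ ≤ 2 * (σ ^ 2 / 2 * n) * n := by gcongr
      _ = _ := by ring
  set r : ℕ := ⌈10 * t / γ⌉₊ with hr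
  have hr1 : 10 * t ≤ γ * r := by
    have := Nat.le_ceil (10 * t / γ)
    rw [div_le_iff₀ h0] at this
    linarith
  have hr2 : γ * r ≤ 11 * t := by
    have := (Nat.ceil_lt_add_one (show 0 ≤ 10 * t / γ by positivity)).le
    rw [← hr, div_add_one h0.ne', le_div_iff₀ h0] at this
    linarith
  have hr3 : 20 * t ≤ r := by nlinarith [Nat.cast_nonneg (α := ℝ) r]
  have htn : t ≤ t * k := le_mul_of_one_le_right (by linarith) (by linarith)
  have hrn : r ≤ n := by
    have h3 : γ * r ≤ γ * n := by nlinarith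
    exact_mod_cast le_of_mul_le_mul_left h3 h0
  clear_value r t
  obtain ⟨n', rfl⟩ : ∃ n', n = n' + r := ⟨n - r, by omega⟩
  set a : ℕ := ⌊γ * r - t⌋₊ with ha
  set b : ℕ := ⌈γ * r + t⌉₊ with hb
  have ha1 : (a : ℝ) ≤ γ * r - t := Nat.floor_le (by linarith)
  have ha2 : γ * r - t < a + 1 := Nat.lt_floor_add_one _
  have hb1 : γ * r + t ≤ b := Nat.le_ceil _
  have hb2 : (b : ℝ) < γ * r + t + 1 := Nat.ceil_lt_add_one (by linarith)
  have hab : b + 1 ≤ 2 * a := by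
    have : (b : ℝ) < 2 * a := by linarith
    exact_mod_cast this
  have hbr : 3 * b + 2 ≤ 2 * r := by
    have h5 : γ * r ≤ 1 / 2 * r := by gcongr
    have : (3 : ℝ) * b + 2 ≤ 2 * r := by linarith
    exact_mod_cast this
  have main := two_rpow_momentExponent_le_card_mul (n := n') (i := i) h0 h1 (by linarith : 0 < t) (by
    rw [htsq]; push_cast; nlinarith [Nat.cast_nonneg (α := ℝ) r]) hk (by rw [hi]; push_cast; ring) hie ha1 hb1 hab hbr
  have hfac : (2 : ℝ) * (2 / γ) ^ (k * r) ≤ 2 ^ (δ * (n' + r : ℕ)) := by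
    have e1 : (2 / γ) ^ (k * r) = (2 : ℝ) ^ (Lg * (k * r : ℕ)) := by
      rw [Real.rpow_mul (by norm_num), hLg, Real.rpow_logb (by norm_num) (by norm_num)
        (by positivity), Real.rpow_natCast]
    have e2 : (2 : ℝ) * 2 ^ (Lg * (k * r : ℕ)) = 2 ^ (1 + Lg * (k * r : ℕ)) := by
      rw [Real.rpow_add (by norm_num), Real.rpow_one]
    rw [e1, e2]
    refine Real.rpow_le_rpow_of_exponent_le (by norm_num) ?_
    have e3 : γ * (k * r) ≤ 11 * (σ * (n' + r : ℕ)) := by nlinarith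
    have e4 : γ * (Lg * (k * r)) ≤ γ * (δ / 2 * (n' + r : ℕ)) := by
      calc γ * (Lg * (k * r)) = Lg * (γ * (k * r)) := by ring
        _ ≤ Lg * (11 * (σ * (n' + r : ℕ))) := by gcongr
        _ = 11 * σ * Lg * (n' + r : ℕ) := by ring
        _ ≤ γ * (δ / 2) * (n' + r : ℕ) := by gcongr
        _ = _ := by ring
    have e5 := le_of_mul_le_mul_left e4 h0
    push_cast at e5 hnδ ⊢
    linarith
  rw [Real.rpow_sub (by norm_num), div_le_iff₀ (by positivity)]
  exact main.trans (mul_le_mul_of_nonneg_left hfac (Nat.cast_nonneg _))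

end SmallLowerBound

/-! ### Krawtchouk values through coefficientwise domination -/

section Domination

open Polynomial

/-- Coefficientwise domination of a polynomial by another one. -/
def CoeffDominated (P Q : ℝ[X]) : Prop := ∀ l, |P.coeff l| ≤ Q.coeff l

lemma CoeffDominated.mul {P Q P' Q' : ℝ[X]} (h : CoeffDominated P Q) (h' : CoeffDominated P' Q') :
    CoeffDominated (P * P') (Q * Q') := by
  intro l
  rw [coeff_mul, coeff_mul]
  refine (abs_sum_le_sum_abs _ _).trans (sum_le_sum fun x _ => ?_)
  rw [abs_mul]
  exact mul_le_mul (h _) (h' _) (abs_nonneg _) ((abs_nonneg _).trans (h _))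

lemma CoeffDominated.pow {P Q : ℝ[X]} (h : CoeffDominated P Q) (s : ℕ) :
    CoeffDominated (P ^ s) (Q ^ s) := by
  induction s with
  | zero =>
    intro l
    rw [pow_zero, pow_zero, coeff_one]
    split_ifs <;> simp
  | succ s ih => rw [pow_succ, pow_succ]; exact ih.mul h

lemma coeffDominated_one_sub_X : CoeffDominated (1 - X) (1 + X) := by
  intro l
  rw [coeff_sub, coeff_add, coeff_one, coeff_X]
  split_ifs <;> simp_all

lemma coeffDominated_one_add_X : CoeffDominated (1 + X) (1 + X) := by
  intro l
  rw [coeff_add, coeff_one, coeff_X]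
  split_ifs <;> simp_all

lemma coeffDominated_one_sub_X_sq : CoeffDominated (1 - X ^ 2) (1 + X ^ 2) := by
  intro l
  rw [coeff_sub, coeff_add, coeff_one, coeff_X_pow]
  split_ifs <;> simp_all

/-- The Krawtchouk generating polynomial is dominated by `(1 + X²) ^ s (1 + X) ^ (n - 2 s)`. -/
lemma coeffDominated_krawtchouk {j l s : ℕ} (hj : s ≤ j) (hl : s ≤ l) :
    CoeffDominated ((1 - X) ^ j * (1 + X) ^ l) ((1 + X ^ 2) ^ s * (1 + X) ^ (j + l - 2 * s)) := by
  -- Pairing `s` factors `1 - X` with `s` factors `1 + X` into `1 - X ^ 2` retains cancellation that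
  -- termwise absolute values would lose.
  have e : ((1 - X) ^ j * (1 + X) ^ l : ℝ[X]) =
      (1 - X ^ 2) ^ s * ((1 - X) ^ (j - s) * (1 + X) ^ (l - s)) := by
    obtain ⟨j', rfl⟩ := Nat.exists_eq_add_of_le hj
    obtain ⟨l', rfl⟩ := Nat.exists_eq_add_of_le hl
    rw [show (1 - X ^ 2 : ℝ[X]) = (1 - X) * (1 + X) by ring, mul_pow, Nat.add_sub_cancel_left,
      Nat.add_sub_cancel_left]
    ring
  have e' : ((1 + X) ^ (j + l - 2 * s) : ℝ[X]) = (1 + X) ^ (j - s) * (1 + X) ^ (l - s) := by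
    rw [← pow_add]; congr 1; omega
  rw [e, e']
  exact (coeffDominated_one_sub_X_sq.pow s).mul
    ((coeffDominated_one_sub_X.pow _).mul (coeffDominated_one_add_X.pow _))

lemma coeff_mul_pow_le_eval {Q : ℝ[X]} (hQ : ∀ l, 0 ≤ Q.coeff l) {α : ℝ} (hα : 0 ≤ α) (i : ℕ) :
    Q.coeff i * α ^ i ≤ Q.eval α := by
  rw [eval_eq_sum_range]
  by_cases hi : i ≤ Q.natDegree
  · exact single_le_sum (f := fun l => Q.coeff l * α ^ l)
      (fun l _ => mul_nonneg (hQ l) (pow_nonneg hα l)) (mem_range.2 (Nat.lt_succ_of_le hi))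
  · rw [coeff_eq_zero_of_natDegree_lt (not_le.1 hi), zero_mul]
    exact sum_nonneg fun l _ => mul_nonneg (hQ l) (pow_nonneg hα l)

/-- The Krawtchouk polynomial: the character sum over the words of weight `i`. -/
noncomputable def layerCharacterSum {ι : Type*} [Fintype ι] [DecidableEq ι] (i : ℕ)
    (u : ι → ZMod 2) : ℝ := ∑ x ∈ layer ι i, binarySign (∑ r, u r * x r)

variable {ι : Type*} [Fintype ι] [DecidableEq ι]

lemma layerCharacterSum_eq_coeff (i : ℕ) (u : ι → ZMod 2) :
    layerCharacterSum i u =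
      ((1 - X) ^ hammingNorm u * (1 + X) ^ (Fintype.card ι - hammingNorm u) : ℝ[X]).coeff i := by
  have h1 : ((1 - X) ^ hammingNorm u * (1 + X) ^ (Fintype.card ι - hammingNorm u) : ℝ[X]) =
      ∏ r, ∑ t : ZMod 2, C (binarySign (u r * t)) * (if t = 0 then 1 else X) := by
    have h2 : ∀ r, ∑ t : ZMod 2, C (binarySign (u r * t)) * (if t = 0 then 1 else X : ℝ[X]) =
        if u r ≠ 0 then 1 - X else 1 + X := by
      intro r
      rcases zmod_two_eq (u r) with h | h <;> simp [sum_zmod_two, h, sub_eq_add_neg]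
    simp_rw [h2]
    rw [prod_ite, prod_const, prod_const, hammingNorm]
    congr 2
    have := card_filter_add_card_filter_not (s := (univ : Finset ι)) (fun r => u r ≠ 0)
    rw [card_univ] at this
    omega
  rw [h1, Fintype.prod_sum, finsetSum_coeff, layerCharacterSum, layer, sum_filter]
  refine sum_congr rfl fun x _ => ?_
  have h3 : ∏ r, C (binarySign (u r * x r)) * (if x r = 0 then 1 else X : ℝ[X]) =
      C (binarySign (∑ r, u r * x r)) * X ^ hammingNorm x := by
    rw [prod_mul_distrib, binarySign_sum, map_prod]
    congr 1
    rw [hammingNorm, prod_ite]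
    simp
  rw [h3, coeff_C_mul, coeff_X_pow]
  simp [eq_comm]

lemma abs_layerCharacterSum_le_eval {α : ℝ} (hα : 0 ≤ α) (i : ℕ) (u : ι → ZMod 2) {s : ℕ}
    (h1 : s ≤ hammingNorm u) (h2 : s ≤ Fintype.card ι - hammingNorm u) :
    |layerCharacterSum i u| * α ^ i ≤ (1 + α ^ 2) ^ s * (1 + α) ^ (Fintype.card ι - 2 * s) := by
  have hle : hammingNorm u ≤ Fintype.card ι := hammingNorm_le_card_fintype
  have hdom := coeffDominated_krawtchouk h1 h2
  rw [Nat.add_sub_cancel' hle] at hdom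
  have := coeff_mul_pow_le_eval (fun l => (abs_nonneg _).trans (hdom l)) hα i
  rw [layerCharacterSum_eq_coeff]
  refine (mul_le_mul_of_nonneg_right (hdom i) (by positivity)).trans (this.trans_eq ?_)
  simp

/-- Domination with `s = 1`, using `(1 + X ^ 2) (1 + X) ^ (n - 2) = (1 + X) ^ n - 2 X (1 + X) ^ (n -
2)`. -/
lemma abs_layerCharacterSum_le_sub (i : ℕ) (u : ι → ZMod 2)
    (h1 : 1 ≤ hammingNorm u) (h2 : 1 ≤ Fintype.card ι - hammingNorm u) :
    |layerCharacterSum (i + 1) u| ≤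
      (Fintype.card ι).choose (i + 1) - 2 * (Fintype.card ι - 2).choose i := by
  have hle : hammingNorm u ≤ Fintype.card ι := hammingNorm_le_card_fintype
  have hdom := coeffDominated_krawtchouk h1 h2
  rw [Nat.add_sub_cancel' hle] at hdom
  rw [layerCharacterSum_eq_coeff]
  refine (hdom (i + 1)).trans_eq ?_
  obtain ⟨n, hn⟩ : ∃ n, Fintype.card ι = n + 2 := ⟨Fintype.card ι - 2, by omega⟩
  rw [hn]
  simp only [mul_one, pow_one, Nat.add_sub_cancel]
  have e : ((1 + X ^ 2) * (1 + X) ^ n : ℝ[X]) = (1 + X) ^ (n + 2) - C 2 * (X * (1 + X) ^ n) := by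
    rw [show (C 2 : ℝ[X]) = 2 from rfl]; ring
  rw [e, coeff_sub, coeff_C_mul, coeff_X_mul, coeff_one_add_X_pow, coeff_one_add_X_pow]

lemma layerCharacterSum_zero (i : ℕ) :
    layerCharacterSum i (0 : ι → ZMod 2) = (layer ι i).card := by
  simp [layerCharacterSum]

lemma layerCharacterSum_one {i : ℕ} (hi : Even i) :
    layerCharacterSum i (1 : ι → ZMod 2) = (layer ι i).card := by
  rw [layerCharacterSum, card_eq_sum_ones, Nat.cast_sum]
  refine sum_congr rfl fun x hx => ?_
  rw [mem_layer] at hx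
  have : ∑ r, (1 : ι → ZMod 2) r * x r = ((hammingNorm x : ℕ) : ZMod 2) := by
    rw [hammingNorm, card_filter, Nat.cast_sum]
    refine sum_congr rfl fun r _ => ?_
    rcases zmod_two_eq (x r) with h | h <;> simp [h]
  rw [this, hx, (ZMod.natCast_eq_zero_iff i 2).2 hi.two_dvd]
  simp

/-- Fourier inversion at zero for the `k`-fold convolution of the layer indicator. -/
lemma card_zeroSumFamilies_mul_two_pow (i k : ℕ) :
    ((zeroSumFamilies (Fin k) ι i).card : ℝ) * 2 ^ Fintype.card ι =
      ∑ u : ι → ZMod 2, layerCharacterSum i u ^ k := by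
  have h1 : ∀ u : ι → ZMod 2, layerCharacterSum i u ^ k =
      ∑ x ∈ Fintype.piFinset fun _ : Fin k => layer ι i,
        binarySign (∑ r, u r * (∑ j, x j) r) := by
    intro u
    rw [layerCharacterSum, sum_pow']
    refine sum_congr rfl fun x _ => ?_
    rw [← binarySign_sum, sum_comm]
    congr 1
    refine sum_congr rfl fun r _ => ?_
    rw [Finset.sum_apply, mul_sum]
  simp_rw [h1]
  rw [sum_comm]
  simp_rw [sum_prod_binarySign]
  rw [← sum_filter, sum_const, nsmul_eq_mul]
  congr 3
  ext x
  simp [Fintype.mem_piFinset]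

end Domination

/-! ### Lower bound for large `k` through Krawtchouk power sums -/

section LargeLowerBound

lemma choose_sub_two_mul_eq {n i : ℕ} (hn : 2 ≤ n) (hi : 1 ≤ i) (hin : i ≤ n) :
    ((n - 2).choose (i - 1) : ℝ) * (n * (n - 1)) = n.choose i * (i * (n - i)) := by
  obtain ⟨l, rfl⟩ := Nat.exists_eq_add_of_le' hn
  obtain ⟨j, rfl⟩ := Nat.exists_eq_add_of_le' hi
  have h1 := Nat.add_one_mul_choose_eq (l + 1) j
  have h2 := Nat.choose_mul_succ_eq l j
  have h2' : (l.choose j : ℝ) * (l + 1) = (l + 1).choose j * (l + 1 - j) := by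
    rw [← Nat.cast_add_one l, ← Nat.cast_sub (by omega)]
    exact_mod_cast h2
  have h1' : ((l : ℝ) + 1 + 1) * (l + 1).choose j = (l + 1 + 1).choose (j + 1) * (j + 1) := by
    exact_mod_cast h1
  simp only [Nat.add_sub_cancel]
  push_cast
  linear_combination ((l : ℝ) + 2) * h2' + (l + 1 - (j : ℝ)) * h1'

lemma abs_layerCharacterSum_le_mul_choose {γ : ℝ} (h0 : 0 < γ) (h1 : γ < 1) {n i : ℕ}
    (hi : (i : ℝ) = γ * n) {u : Fin n → ZMod 2} (hu0 : 1 ≤ hammingNorm u)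
    (hu1 : 1 ≤ n - hammingNorm u) :
    |layerCharacterSum i u| ≤ (1 - 2 * (γ * (1 - γ))) * n.choose i := by
  have hn : 2 ≤ n := by omega
  have hn' : (2 : ℝ) ≤ n := by exact_mod_cast hn
  have hi0 : 0 < (i : ℝ) := by rw [hi]; positivity
  have hi1 : 1 ≤ i := by exact_mod_cast hi0
  have hin : i ≤ n := by
    have : (i : ℝ) ≤ n := by rw [hi]; nlinarith
    exact_mod_cast this
  have h := abs_layerCharacterSum_le_sub (ι := Fin n) (i - 1) u hu0 (by simpa using hu1)
  rw [Nat.sub_add_cancel hi1, Fintype.card_fin] at h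
  have e := choose_sub_two_mul_eq hn hi1 hin
  have hc : γ * (1 - γ) * n.choose i ≤ (n - 2).choose (i - 1) := by
    have hpos : (0 : ℝ) < n * (n - 1) := by nlinarith
    refine le_of_mul_le_mul_right ?_ hpos
    rw [e, hi]
    have : 0 ≤ γ * (1 - γ) * n.choose i * n := by
      have : 0 < 1 - γ := by linarith
      positivity
    nlinarith
  linarith

/-- Evaluate the dominating polynomial at the odds `γ / (1 - γ)`; the factor `n + 1` is the loss in
bounding a coefficient by a value. -/
lemma abs_layerCharacterSum_le_pow_mul_choose {γ : ℝ} (h0 : 0 < γ) (h1 : γ < 1) {n i s : ℕ}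
    (hi : (i : ℝ) = γ * n) {u : Fin n → ZMod 2} (hu0 : s ≤ hammingNorm u)
    (hu1 : s ≤ n - hammingNorm u) :
    |layerCharacterSum i u| ≤ (n + 1) * (1 - 2 * (γ * (1 - γ))) ^ s * n.choose i := by
  have h2 : 0 < 1 - γ := by linarith
  have hin : i ≤ n := by
    have : (i : ℝ) ≤ n := by rw [hi]; nlinarith [Nat.cast_nonneg (α := ℝ) n]
    exact_mod_cast this
  have hρ : 0 ≤ 1 - 2 * (γ * (1 - γ)) := by nlinarith [sq_nonneg (1 - 2 * γ)]
  have h := abs_layerCharacterSum_le_eval (α := γ / (1 - γ)) (by positivity) i u hu0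
    (by simpa using hu1)
  rw [Fintype.card_fin] at h
  have hs : 2 * s ≤ n := by omega
  have e1 : |layerCharacterSum i u| * (γ ^ i * (1 - γ) ^ (n - i)) ≤
      (1 - 2 * (γ * (1 - γ))) ^ s := by
    have := mul_le_mul_of_nonneg_right h (pow_nonneg h2.le n)
    refine le_of_eq_of_le ?_ (this.trans_eq ?_)
    · obtain ⟨l, rfl⟩ := Nat.exists_eq_add_of_le hin
      rw [Nat.add_sub_cancel_left, div_pow, pow_add]
      field_simp
    · obtain ⟨l, rfl⟩ := Nat.exists_eq_add_of_le hs
      rw [Nat.add_sub_cancel_left, show 1 + (γ / (1 - γ)) ^ 2 =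
        (1 - 2 * (γ * (1 - γ))) / (1 - γ) ^ 2 by field_simp; ring,
        show 1 + γ / (1 - γ) = 1 / (1 - γ) by field_simp; ring, div_pow, div_pow, one_pow, pow_add,
        ← pow_mul]
      field_simp
  have e2 := one_le_succ_mul_choose_mul_pow h0 h1 hi
  have hw : 0 < γ ^ i * (1 - γ) ^ (n - i) := by positivity
  refine le_of_mul_le_mul_right (e1.trans ?_) hw
  have := mul_le_mul_of_nonneg_left e2 (pow_nonneg hρ s)
  linarith

/-- Replacing `ρ = 1 - 2 γ (1 - γ)` by its `T`-th root `q` removes the factor `n + 1`: up to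
distance `T` the single saving `ρ = q ^ T` suffices, and beyond it the excess decay absorbs `n + 1`.
-/
lemma abs_layerCharacterSum_le_root_pow {γ q : ℝ} (h0 : 0 < γ) (h1 : γ < 1) {n i T : ℕ}
    (hi : (i : ℝ) = γ * n) (hq0 : 0 < q) (hq1 : q ≤ 1) (hqT : q ^ T = 1 - 2 * (γ * (1 - γ)))
    (hT : (n + 1) * (1 - 2 * (γ * (1 - γ))) ^ (T - 1) ≤ 1) {u : Fin n → ZMod 2}
    (hu0 : 1 ≤ hammingNorm u) (hu1 : 1 ≤ n - hammingNorm u) :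
    |layerCharacterSum i u| ≤ q ^ min (hammingNorm u) (n - hammingNorm u) * n.choose i := by
  set s := min (hammingNorm u) (n - hammingNorm u) with hs
  rcases le_or_gt s T with hsT | hsT
  · refine (abs_layerCharacterSum_le_mul_choose h0 h1 hi hu0 hu1).trans ?_
    rw [← hqT]
    gcongr ?_ * _
    exact pow_le_pow_of_le_one hq0.le hq1 hsT
  · refine (abs_layerCharacterSum_le_pow_mul_choose h0 h1 (s := s) hi (min_le_left _ _)
      (min_le_right _ _)).trans ?_
    gcongr ?_ * _
    rcases Nat.eq_zero_or_pos T with hT0 | hT0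
    · rw [hT0, pow_zero] at hqT
      rw [hT0] at hT
      simp only [zero_tsub, pow_zero, mul_one] at hT
      have hn : (n : ℝ) ≤ 0 := by linarith
      have : n = 0 := by exact_mod_cast le_antisymm hn (Nat.cast_nonneg n)
      omega
    · have hle : s + T * (T - 1) ≤ T * s := by
        obtain ⟨T', rfl⟩ := Nat.exists_eq_add_of_le' hT0
        simp only [Nat.add_sub_cancel]
        nlinarith
      rw [← hqT, ← pow_mul] at hT ⊢
      calc (n + 1 : ℝ) * q ^ (T * s) ≤ (n + 1) * q ^ (s + T * (T - 1)) := by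
            gcongr ?_ * ?_
            exact pow_le_pow_of_le_one hq0.le hq1 hle
        _ = q ^ s * ((n + 1) * q ^ (T * (T - 1))) := by rw [pow_add]; ring
        _ ≤ q ^ s * 1 := by gcongr
        _ = q ^ s := mul_one _

lemma sum_pow_hammingNorm (Q : ℝ) (n : ℕ) :
    ∑ u : Fin n → ZMod 2, Q ^ hammingNorm u = (1 + Q) ^ n := by
  simp_rw [pow_hammingNorm]
  rw [← Fintype.prod_sum (fun _ (t : ZMod 2) => if t = 0 then (1 : ℝ) else Q)]
  simp [sum_zmod_two]

lemma hammingNorm_add_one {n : ℕ} (u : Fin n → ZMod 2) :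
    hammingNorm (u + 1) = n - hammingNorm u := by
  have h := card_filter_add_card_filter_not (s := (univ : Finset (Fin n))) (fun r => u r ≠ 0)
  rw [card_univ, Fintype.card_fin] at h
  have h2 : hammingNorm (u + 1) = (univ.filter fun r => ¬ (u r ≠ 0)).card := by
    rw [hammingNorm]
    congr 1
    ext r
    have : ∀ a : ZMod 2, a + 1 ≠ 0 ↔ ¬ (a ≠ 0) := by decide
    simpa using this (u r)
  rw [h2, hammingNorm]
  omega

theorem choose_pow_le_card_zeroSumFamilies_mul {γ : ℝ} (h0 : 0 < γ) (h1 : γ < 1) {n i k T : ℕ}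
    (hn : 0 < n) (hi : (i : ℝ) = γ * n) (hie : Even i) (hT1 : 1 ≤ T)
    (hT : 4 * (n + 1) * (1 - 2 * (γ * (1 - γ))) ^ (T - 1) ≤ 1) (hk : T ^ 2 ≤ k) :
    (n.choose i : ℝ) ^ k ≤ (zeroSumFamilies (Fin k) (Fin n) i).card * 2 ^ n := by
  set ρ := 1 - 2 * (γ * (1 - γ)) with hρ
  have h2 : 0 < 1 - γ := by linarith
  have hρ0 : 0 < ρ := by rw [hρ]; nlinarith [sq_nonneg (1 - 2 * γ)]
  have hρ1 : ρ ≤ 1 := by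
    have := mul_pos h0 h2
    linarith
  set q : ℝ := ρ ^ ((T : ℝ)⁻¹) with hq
  have hqT : q ^ T = ρ := Real.rpow_inv_natCast_pow hρ0.le (by omega)
  have hq0 : 0 < q := Real.rpow_pos_of_pos hρ0 _
  have hq1 : q ≤ 1 := Real.rpow_le_one hρ0.le hρ1 (by positivity)
  set L : ℝ := (n.choose i : ℝ) with hL
  have hL0 : 0 ≤ L := Nat.cast_nonneg _
  set Q : ℝ := q ^ k with hQ
  have hQ0 : 0 ≤ Q := by positivity
  -- The hypothesis `T ^ 2 ≤ k` recovers the power of `ρ` given up by passing to the root `q`.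
  have hQρ : Q ≤ ρ ^ (T - 1) := by
    rw [hQ, ← hqT, ← pow_mul]
    refine pow_le_pow_of_le_one hq0.le hq1 (le_trans ?_ hk)
    rw [sq]; exact Nat.mul_le_mul_left _ (by omega)
  have hnQ : 4 * (n * Q) ≤ 1 := by
    have h3 : (n : ℝ) * Q ≤ (n + 1) * ρ ^ (T - 1) := by gcongr; linarith
    linarith
  have hexp : (1 + Q) ^ n ≤ 1 + 2 * (n * Q) := by
    have h3 : (1 + Q) ^ n ≤ Real.exp (n * Q) := by
      rw [Real.exp_nat_mul]
      exact pow_le_pow_left₀ (by positivity) (by rw [add_comm]; exact Real.add_one_le_exp Q) n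
    have h4 := Real.abs_exp_sub_one_le (x := n * Q) (by
      rw [abs_of_nonneg (by positivity)]; linarith)
    rw [abs_of_nonneg (by positivity : (0 : ℝ) ≤ n * Q)] at h4
    have := le_abs_self (Real.exp (n * Q) - 1)
    linarith
  have hLcard : ((layer (Fin n) i).card : ℝ) = L := by rw [card_layer, Fintype.card_fin]
  have h01 : (0 : Fin n → ZMod 2) ≠ 1 := by
    intro h
    have := congrFun h ⟨0, hn⟩
    simp at this
  have hterm : ∀ u : Fin n → ZMod 2, u ≠ 0 → u ≠ 1 →
      -(L ^ k * (Q ^ hammingNorm u + Q ^ hammingNorm (u + 1))) ≤ layerCharacterSum i u ^ k := by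
    intro u hu0 hu1
    have hu0' : 1 ≤ hammingNorm u := Nat.one_le_iff_ne_zero.2 (by simpa using hu0)
    have hu1' : 1 ≤ n - hammingNorm u := by
      rw [← hammingNorm_add_one]
      refine Nat.one_le_iff_ne_zero.2 ?_
      rw [Ne, hammingNorm_eq_zero]
      intro h
      apply hu1
      have : u + 1 + 1 = 0 + 1 := by rw [h]
      rw [add_assoc, zero_add] at this
      rw [← this]
      ext r
      have : ∀ a : ZMod 2, a = a + (1 + 1) := by decide
      simpa using this (u r)
    have hb := abs_layerCharacterSum_le_root_pow h0 h1 hi hq0 hq1 hqT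
      (by
        have : 0 ≤ (n + 1 : ℝ) * ρ ^ (T - 1) := by positivity
        rw [← hρ]
        linarith) hu0' hu1'
    have hb2 : |layerCharacterSum i u ^ k| ≤
        L ^ k * (Q ^ hammingNorm u + Q ^ hammingNorm (u + 1)) := by
      rw [abs_pow, hammingNorm_add_one]
      refine (pow_le_pow_left₀ (abs_nonneg _) hb k).trans ?_
      rw [mul_pow, mul_comm, ← pow_mul, mul_comm _ k, pow_mul]
      gcongr
      rcases min_choice (hammingNorm u) (n - hammingNorm u) with h | h <;> rw [h]
      · exact le_add_of_nonneg_right (by positivity)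
      · exact le_add_of_nonneg_left (by positivity)
    exact (abs_le.1 hb2).1
  have hsumQ := sum_pow_hammingNorm Q n
  have hsumQ' : ∑ u : Fin n → ZMod 2, Q ^ hammingNorm (u + 1) = (1 + Q) ^ n := by
    rw [← hsumQ]
    exact Fintype.sum_equiv (Equiv.addRight (1 : Fin n → ZMod 2)) _ _ fun u => rfl
  have hcard := card_zeroSumFamilies_mul_two_pow (ι := Fin n) i k
  rw [Fintype.card_fin] at hcard
  rw [hcard]
  have hsplit : ∀ g : (Fin n → ZMod 2) → ℝ,
      ∑ u, g u = g 0 + (g 1 + ∑ u ∈ (univ.erase 0).erase 1, g u) := by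
    intro g
    rw [add_sum_erase _ _ (mem_erase.2 ⟨h01.symm, mem_univ _⟩), add_sum_erase _ _ (mem_univ _)]
  rw [hsplit, layerCharacterSum_zero, layerCharacterSum_one hie, hLcard]
  have hrest : ∑ u ∈ (univ.erase (0 : Fin n → ZMod 2)).erase 1,
      -(L ^ k * (Q ^ hammingNorm u + Q ^ hammingNorm (u + 1))) ≤ ∑ u ∈ (univ.erase (0 : Fin n → ZMod 2)).erase 1, layerCharacterSum i u ^ k := by
    refine sum_le_sum fun u hu => ?_
    rw [mem_erase, mem_erase] at hu
    exact hterm u hu.2.1 hu.1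
  rw [sum_neg_distrib, ← mul_sum] at hrest
  have htotal := hsplit fun u : Fin n → ZMod 2 => Q ^ hammingNorm u + Q ^ hammingNorm (u + 1)
  rw [sum_add_distrib, hsumQ, hsumQ'] at htotal
  have hz1 : hammingNorm ((1 : Fin n → ZMod 2) + 1) = 0 := by
    rw [hammingNorm_eq_zero]
    ext r
    exact CharTwo.add_self_eq_zero (1 : ZMod 2)
  simp only [hammingNorm_zero, pow_zero, hz1] at htotal
  have hp1 : 0 ≤ Q ^ hammingNorm ((0 : Fin n → ZMod 2) + 1) := by positivity
  have hp2 : 0 ≤ Q ^ hammingNorm (1 : Fin n → ZMod 2) := by positivity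
  set R := ∑ u ∈ (univ.erase (0 : Fin n → ZMod 2)).erase 1,
    (Q ^ hammingNorm u + Q ^ hammingNorm (u + 1)) with hR
  -- Removing `u = 0` and `u = 1` takes at least `2` from `2 (1 + Q) ^ n`, leaving at most `4 n Q ≤
  -- 1`.
  have hR1 : R ≤ 1 := by linarith
  have := mul_le_mul_of_nonneg_left hR1 (pow_nonneg hL0 k)
  linarith

end LargeLowerBound

/-! ### Joining the two regimes -/

section LowerBound

/-- The sixth root turns `k ^ 3 > η n` into `T ^ 2 ≤ k`, while `T` still grows like a power of `n`,
so the geometric factor wins. -/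
lemma exists_pow_six_le_and_geometric_le {η ρ : ℝ} (hη : 0 < η) (hρ0 : 0 < ρ) (hρ1 : ρ < 1) :
    ∃ n₀ : ℕ, ∀ n : ℕ, n₀ ≤ n → ∃ T : ℕ, 1 ≤ T ∧ (T : ℝ) ^ 6 ≤ η * n ∧
      4 * (n + 1) * ρ ^ (T - 1) ≤ 1 := by
  have hlim := tendsto_pow_const_mul_const_pow_of_abs_lt_one 6 (r := ρ)
    (by rw [abs_of_pos hρ0]; exact hρ1)
  set K : ℝ := 4 * (64 / η + 1) / ρ with hK
  have hK0 : 0 < K := by positivity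
  obtain ⟨T₀, hT₀⟩ := Filter.eventually_atTop.1
    (hlim.eventually (Iio_mem_nhds (show (0 : ℝ) < 1 / K by positivity)))
  obtain ⟨n₀, hn₀⟩ := exists_nat_ge (((T₀ : ℝ) + 1) ^ 6 / η)
  refine ⟨n₀, fun n hn => ?_⟩
  have hn' : ((T₀ : ℝ) + 1) ^ 6 ≤ η * n := by
    have : ((T₀ : ℝ) + 1) ^ 6 / η ≤ n := hn₀.trans (by exact_mod_cast hn)
    rw [div_le_iff₀ hη] at this
    linarith
  set x : ℝ := (η * n) ^ ((6 : ℕ) : ℝ)⁻¹ with hx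
  have hηn : 0 ≤ η * n := by positivity
  have hx0 : 0 ≤ x := by positivity
  have hx6 : x ^ 6 = η * n := Real.rpow_inv_natCast_pow hηn (by norm_num)
  have hxT : (T₀ : ℝ) + 1 ≤ x := by
    refine le_of_pow_le_pow_left₀ (n := 6) (by norm_num) hx0 ?_
    rw [hx6]; exact hn'
  have hT : T₀ + 1 ≤ ⌊x⌋₊ := Nat.le_floor (by push_cast; exact hxT)
  set T := ⌊x⌋₊ with hTdef
  have hTx : (T : ℝ) ≤ x := Nat.floor_le hx0
  have hxT' : x ≤ T + 1 := (Nat.lt_floor_add_one x).le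
  have hT1 : 1 ≤ T := by omega
  have hT1' : (1 : ℝ) ≤ T := by exact_mod_cast hT1
  refine ⟨T, hT1, ?_, ?_⟩
  · rw [← hx6]; gcongr
  · have hlt : (T : ℝ) ^ 6 * ρ ^ T < 1 / K := hT₀ T (by omega)
    have h1 : η * n ≤ 64 * T ^ 6 := by
      rw [← hx6]
      calc x ^ 6 ≤ (2 * T) ^ 6 := by gcongr; linarith
        _ = _ := by ring
    have h2 : (n : ℝ) + 1 ≤ (64 / η + 1) * T ^ 6 := by
      have h3 : (n : ℝ) ≤ 64 / η * T ^ 6 := by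
        rw [div_mul_eq_mul_div, le_div_iff₀ hη]; linarith
      have h4 : (1 : ℝ) ≤ T ^ 6 := one_le_pow₀ hT1'
      linarith
    have hρT : ρ ^ (T - 1) = ρ ^ T / ρ := by
      rw [eq_div_iff hρ0.ne', ← pow_succ]; congr 1; omega
    calc 4 * ((n : ℝ) + 1) * ρ ^ (T - 1) ≤ 4 * ((64 / η + 1) * T ^ 6) * ρ ^ (T - 1) := by gcongr
      _ = K * (T ^ 6 * ρ ^ T) := by rw [hρT, hK]; ring
      _ ≤ K * (1 / K) := by gcongr
      _ = 1 := by field_simp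

theorem exists_forall_lower_bound {γ δ : ℝ} (h0 : 0 < γ) (h1 : γ < 1 / 2) (hδ : 0 < δ) :
    ∃ n₀ : ℕ, ∀ n i k : ℕ, n₀ ≤ n → 4 ≤ k → (i : ℝ) = γ * n → Even i →
      (2 : ℝ) ^ (momentExponent k γ * n - δ * n) ≤
        (zeroSumFamilies (Fin k) (Fin n) i).card * (n + 1) ^ k := by
  obtain ⟨η, hη, n₁, hsmall⟩ := exists_lower_bound_of_pow_three_le h0 h1 hδ
  have h2 : 0 < 1 - γ := by linarith
  have hγγ := mul_pos h0 h2
  obtain ⟨n₂, hroot⟩ := exists_pow_six_le_and_geometric_le (ρ := 1 - 2 * (γ * (1 - γ))) hη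
    (by nlinarith [sq_nonneg (1 - 2 * γ)]) (by linarith)
  have hpow : Filter.Tendsto (fun b : ℕ => (1 - 2 * γ) ^ b) Filter.atTop (nhds 0) :=
    tendsto_pow_atTop_nhds_zero_of_lt_one (by linarith) (by linarith)
  have l2 : 0 < Real.log 2 := Real.log_pos (by norm_num)
  obtain ⟨b₀, hb₀⟩ := Filter.eventually_atTop.1
    (hpow.eventually (Iio_mem_nhds (mul_pos hδ l2)))
  obtain ⟨n₃, hn₃⟩ := exists_nat_ge ((b₀ : ℝ) ^ 3 / η)
  refine ⟨max (max n₁ n₂) (max n₃ 1), fun n i k hn hk hi hie => ?_⟩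
  have hn1 : n₁ ≤ n := by omega
  have hn2 : n₂ ≤ n := by omega
  have hn3 : n₃ ≤ n := by omega
  have hn0 : 0 < n := by omega
  rcases le_or_gt ((k : ℝ) ^ 3) (η * n) with hk3 | hk3
  · refine (hsmall n i k hn1 hk hk3 hi hie).trans ?_
    refine le_mul_of_one_le_right (Nat.cast_nonneg _) (one_le_pow₀ ?_)
    have : (0 : ℝ) ≤ n := Nat.cast_nonneg n
    linarith
  · obtain ⟨T, hT1, hT6, hTρ⟩ := hroot n hn2
    have hTk : T ^ 2 ≤ k := by
      have h3 : ((T : ℝ) ^ 2) ^ 3 ≤ (k : ℝ) ^ 3 := by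
        rw [← pow_mul]; exact hT6.trans hk3.le
      have h4 := le_of_pow_le_pow_left₀ (by norm_num) (Nat.cast_nonneg k) h3
      exact_mod_cast h4
    have hbk : b₀ ≤ k := by
      have h3 : (b₀ : ℝ) ^ 3 / η ≤ n := hn₃.trans (by exact_mod_cast hn3)
      rw [div_le_iff₀ hη] at h3
      have h4 : (b₀ : ℝ) ^ 3 ≤ (k : ℝ) ^ 3 := by linarith
      have h5 := le_of_pow_le_pow_left₀ (by norm_num) (Nat.cast_nonneg k) h4
      exact_mod_cast h5
    have hlog : Real.logb 2 (1 + (1 - 2 * γ) ^ k) ≤ δ := by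
      refine (logb_one_add_le (pow_nonneg (by linarith) k)).trans ?_
      rw [div_le_iff₀ l2]
      exact (hb₀ k hbk).le
    have hF : momentExponent k γ ≤ k * binaryEntropy γ - 1 + δ := by
      have h3 := momentExponent_le h0 (by linarith) (α := γ / (1 - γ)) (by positivity)
        (by rw [div_lt_one h2]; linarith) k
      rw [exponentAt_odds h0 h1] at h3
      linarith
    have hF' := mul_le_mul_of_nonneg_right hF (Nat.cast_nonneg (α := ℝ) n)
    have hmain := choose_pow_le_card_zeroSumFamilies_mul h0 (by linarith) hn0 hi hie hT1 hTρ hTk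
    have hent := two_rpow_le_succ_mul_choose h0 (by linarith) hi
    have hent' := pow_le_pow_left₀ (by positivity) hent k
    have e1 : ((2 : ℝ) ^ (binaryEntropy γ * n)) ^ k = 2 ^ (k * binaryEntropy γ * n) := by
      rw [← Real.rpow_natCast, ← Real.rpow_mul (by norm_num)]; congr 1; ring
    rw [e1, mul_pow] at hent'
    calc (2 : ℝ) ^ (momentExponent k γ * n - δ * n) ≤ 2 ^ (k * binaryEntropy γ * n - n) :=
          Real.rpow_le_rpow_of_exponent_le (by norm_num) (by linarith)
      _ = 2 ^ (k * binaryEntropy γ * n) / 2 ^ n := by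
          rw [Real.rpow_sub (by norm_num), Real.rpow_natCast]
      _ ≤ (n + 1) ^ k * n.choose i ^ k / 2 ^ n := by gcongr
      _ ≤ (n + 1) ^ k * ((zeroSumFamilies (Fin k) (Fin n) i).card * 2 ^ n) / 2 ^ n := by gcongr
      _ = _ := by field_simp

end LowerBound

/-! ### The variance and the final estimate -/

section Assembly

lemma card_layer_le_card_zeroSumFamilies_two {ι : Type*} [Fintype ι] [DecidableEq ι] (i : ℕ) :
    (layer ι i).card ≤ (zeroSumFamilies (Fin 2) ι i).card := by
  refine card_le_card_of_injOn (fun x _ => x) ?_ ?_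
  · intro x hx
    rw [mem_coe, mem_layer] at hx
    rw [mem_coe, mem_zeroSumFamilies]
    refine ⟨fun _ => hx, ?_⟩
    rw [Fin.sum_univ_two]
    ext r
    exact CharTwo.add_self_eq_zero (x r)
  · intro x _ y _ h
    exact congrFun h 0

lemma half_mul_card_zeroSumFamilies_le {n m i k : ℕ} (hm : 0 < m) (hk : 0 < k) :
    (2 : ℝ) ^ m / 2 * (zeroSumFamilies (Fin k) (Fin n) i).card ≤
      (tensorRelations (Fin k) (Fin n) (Fin m) i).card := by
  have : Nonempty (Fin k) := ⟨⟨0, hk⟩⟩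
  have h := mul_card_zeroSumFamilies_le_card_tensorRelations (κ := Fin k) (ι := Fin n) (μ := Fin m) i
  rw [Fintype.card_fin] at h
  have h1 : 2 ≤ 2 ^ m := Nat.le_self_pow hm.ne' 2
  have h2 : (((2 ^ m - 1 : ℕ) : ℝ)) * (zeroSumFamilies (Fin k) (Fin n) i).card ≤
      (tensorRelations (Fin k) (Fin n) (Fin m) i).card := by exact_mod_cast h
  refine le_trans (mul_le_mul_of_nonneg_right ?_ (Nat.cast_nonneg _)) h2
  rw [Nat.cast_sub (by omega)]
  have h3 : (2 : ℝ) ≤ 2 ^ m := by exact_mod_cast h1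
  push_cast
  linarith

lemma varianceCount_le {γ : ℝ} (h0 : 0 < γ) (h1 : γ < 1) {m n i : ℕ} (hi : (i : ℝ) = γ * n)
    (hi0 : 0 < i) : varianceCount m n i ≤ 2 ^ (binaryEntropy γ * n - m) := by
  rw [varianceCount, centralMomentCount_eq hi0]
  have h := card_tensorRelations_two_le (ι := Fin n) (μ := Fin m) hi0
  rw [card_layer, Fintype.card_fin, Fintype.card_fin] at h
  have h' : ((tensorRelations (Fin 2) (Fin n) (Fin m) i).card : ℝ) ≤ 2 ^ m * n.choose i := by
    exact_mod_cast h
  have hc := choose_le_two_rpow h0 h1 hi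
  rw [Real.rpow_sub (by norm_num), Real.rpow_natCast]
  calc ((2 : ℝ) ^ m)⁻¹ ^ 2 * (tensorRelations (Fin 2) (Fin n) (Fin m) i).card
      ≤ ((2 : ℝ) ^ m)⁻¹ ^ 2 * (2 ^ m * 2 ^ (binaryEntropy γ * n)) := by
        gcongr
        exact h'.trans (by gcongr)
    _ = _ := by field_simp

lemma le_varianceCount {γ : ℝ} (h0 : 0 < γ) (h1 : γ < 1) {m n i : ℕ} (hi : (i : ℝ) = γ * n)
    (hi0 : 0 < i) (hm : 0 < m) :
    (2 : ℝ) ^ (binaryEntropy γ * n - m - 1 - Real.logb 2 (n + 1)) ≤ varianceCount m n i := by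
  rw [varianceCount, centralMomentCount_eq hi0]
  have h := half_mul_card_zeroSumFamilies_le (n := n) (i := i) hm (show 0 < 2 by norm_num)
  have hL : (n.choose i : ℝ) ≤ (zeroSumFamilies (Fin 2) (Fin n) i).card := by
    have := card_layer_le_card_zeroSumFamilies_two (ι := Fin n) i
    rw [card_layer, Fintype.card_fin] at this
    exact_mod_cast this
  have hc := two_rpow_le_succ_mul_choose h0 h1 hi
  have hn1 : (0 : ℝ) < n + 1 := by positivity
  rw [Real.rpow_sub (by norm_num), Real.rpow_sub (by norm_num), Real.rpow_sub (by norm_num),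
    Real.rpow_natCast, Real.rpow_one, Real.rpow_logb (by norm_num) (by norm_num) hn1]
  calc (2 : ℝ) ^ (binaryEntropy γ * n) / 2 ^ m / 2 / (n + 1)
      ≤ (n + 1) * n.choose i / 2 ^ m / 2 / (n + 1) := by gcongr
    _ = ((2 : ℝ) ^ m)⁻¹ ^ 2 * (2 ^ m / 2 * n.choose i) := by field_simp
    _ ≤ ((2 : ℝ) ^ m)⁻¹ ^ 2 * (2 ^ m / 2 * (zeroSumFamilies (Fin 2) (Fin n) i).card) := by gcongr
    _ ≤ _ := by gcongr

lemma inv_two_pow_pow (m k : ℕ) : ((2 : ℝ) ^ m)⁻¹ ^ k = 2 ^ (-((m : ℝ) * k)) := by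
  rw [Real.rpow_neg (by norm_num), inv_pow, ← pow_mul, ← Real.rpow_natCast]
  push_cast
  rfl

lemma logb_succ_le {n : ℕ} (hn : 2 ≤ n) :
    1 ≤ Real.logb 2 n ∧ Real.logb 2 (n + 1) ≤ 2 * Real.logb 2 n := by
  have hn' : (2 : ℝ) ≤ n := by exact_mod_cast hn
  constructor
  · rw [Real.le_logb_iff_rpow_le (by norm_num) (by linarith), Real.rpow_one]
    exact hn'
  · have : 2 * Real.logb 2 (n : ℝ) = Real.logb 2 ((n : ℝ) ^ 2) := by
      rw [Real.logb_pow]; push_cast; rfl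
    rw [this]
    exact Real.logb_le_logb_of_le (by norm_num) (by positivity) (by nlinarith)

end Assembly

end

theorem theorem1p2 (ε : ℝ) (hε : 0 < ε) :
    ∃ c C A : ℝ, 0 < c ∧ 0 < C ∧ 0 < A ∧
      ∀ γ lam : ℝ, 0 < γ → γ < 1 / 2 → 0 < lam → lam < binaryEntropy γ →
        ε = min lam (binaryEntropy γ - lam) →
        ∀ δ : ℝ, 0 < δ → ∃ n₀ : ℕ, ∀ n i m k : ℕ, n₀ ≤ n →
          (i : ℝ) = γ * n → (m : ℝ) = lam * n → Even i →
          C ≤ (k : ℝ) → (k : ℝ) ≤ c * n →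
          (2 : ℝ) ^ (normalizedExponent k γ lam * n - (δ * n + A * k * Real.logb 2 n))
              ≤ normalizedMoment m n i k ∧
          normalizedMoment m n i k
              ≤ (2 : ℝ) ^ (normalizedExponent k γ lam * n + (δ * n + A * k * Real.logb 2 n)) := by
  obtain ⟨b₀, hb₀⟩ := exists_forall_logb_one_add_pow_le hε
  set D₀ : ℕ := ⌈4 / ε⌉₊ with hD₀
  have hD : 4 / ε ≤ D₀ := Nat.le_ceil _
  have hD0 : (0 : ℝ) ≤ D₀ := Nat.cast_nonneg _
  -- `D₀ * b₀` makes circuits of rank at most `D₀` long enough, and `4` serves the filling. In `A`,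
  -- `D₀` pays for the coefficient matrices and `3` for the powers of `2` and `n + 1`.
  refine ⟨ε / 4, D₀ * b₀ + 4, D₀ + 3, by positivity, by positivity, by positivity, ?_⟩
  intro γ lam h0 h1 hlam0 _ hmin δ hδ
  have hεlam : ε ≤ lam := hmin.trans_le (min_le_left _ _)
  have hεgap : ε ≤ binaryEntropy γ - lam := hmin.trans_le (min_le_right _ _)
  obtain ⟨n₁, hlower⟩ := exists_forall_lower_bound h0 h1 hδ
  refine ⟨max n₁ 2, fun n i m k hn hi hm hie hC hkn => ?_⟩
  have hn2 : 2 ≤ n := (le_max_right _ _).trans hn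
  have hn0 : (0 : ℝ) < n := by exact_mod_cast (show 0 < n by omega)
  have hi0 : 0 < i := by
    have : (0 : ℝ) < i := by rw [hi]; positivity
    exact_mod_cast this
  have hm0 : 0 < m := by
    have : (0 : ℝ) < m := by rw [hm]; positivity
    exact_mod_cast this
  have hkC : D₀ * b₀ + 4 ≤ k := by exact_mod_cast hC
  have hk4 : 4 ≤ k := by omega
  have hk4' : (4 : ℝ) ≤ k := by exact_mod_cast hk4
  obtain ⟨hlg1, hlg2⟩ := logb_succ_le hn2
  set lg := Real.logb 2 (n : ℝ) with hlg
  set lg' := Real.logb 2 ((n : ℝ) + 1) with hlg'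
  have hklg : (k : ℝ) ≤ k * lg := le_mul_of_one_le_right (by linarith) hlg1
  have hklg' : (k : ℝ) * lg' ≤ k * (2 * lg) := mul_le_mul_of_nonneg_left hlg2 (by linarith)
  have hDk : (D₀ : ℝ) * k ≤ D₀ * (k * lg) := mul_le_mul_of_nonneg_left hklg hD0
  have hDk0 : 0 ≤ (D₀ : ℝ) * (k * lg) := by positivity
  have hV1 := varianceCount_le (m := m) h0 (by linarith) hi hi0
  have hV2 := le_varianceCount h0 (by linarith) hi hi0 hm0
  have hVpos : 0 < varianceCount m n i := lt_of_lt_of_le (by positivity) hV2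
  have hW1 : varianceCount m n i ^ ((k : ℝ) / 2) ≤ 2 ^ ((binaryEntropy γ * n - m) * (k / 2)) := by
    rw [Real.rpow_mul (by norm_num)]
    exact Real.rpow_le_rpow hVpos.le hV1 (by positivity)
  have hW2 : (2 : ℝ) ^ ((binaryEntropy γ * n - m - 1 - lg') * (k / 2)) ≤
      varianceCount m n i ^ ((k : ℝ) / 2) := by
    rw [Real.rpow_mul (by norm_num)]
    exact Real.rpow_le_rpow (by positivity) hV2 (by positivity)
  have hWpos : 0 < varianceCount m n i ^ ((k : ℝ) / 2) := Real.rpow_pos_of_pos hVpos _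
  rw [normalizedMoment, centralMomentCount_eq hi0, inv_two_pow_pow]
  constructor
  · have hN := hlower n i k ((le_max_left _ _).trans hn) hk4 hi hie
    have hT := half_mul_card_zeroSumFamilies_le (n := n) (i := i) hm0 (show 0 < k by omega)
    have hpow : ((n : ℝ) + 1) ^ k = 2 ^ (k * lg') := by
      rw [mul_comm, Real.rpow_mul (by norm_num), hlg',
        Real.rpow_logb (by norm_num) (by norm_num) (by positivity), Real.rpow_natCast]
    rw [hpow, ← div_le_iff₀ (by positivity), ← Real.rpow_sub (by norm_num)] at hN
    have hT' : (2 : ℝ) ^ ((m : ℝ) - 1 + (momentExponent k γ * n - δ * n - k * lg')) ≤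
        (tensorRelations (Fin k) (Fin n) (Fin m) i).card := by
      refine le_trans ?_ hT
      rw [Real.rpow_add (by norm_num), Real.rpow_sub (by norm_num), Real.rpow_natCast,
        Real.rpow_one]
      gcongr
    rw [le_div_iff₀ hWpos]
    calc _ ≤ (2 : ℝ) ^ (normalizedExponent k γ lam * n - (δ * n + (D₀ + 3) * k * lg)) *
          2 ^ ((binaryEntropy γ * n - m) * (k / 2)) := by gcongr
      _ ≤ 2 ^ (-((m : ℝ) * k)) * 2 ^ ((m : ℝ) - 1 + (momentExponent k γ * n - δ * n - k * lg')) := by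
        rw [← Real.rpow_add (by norm_num), ← Real.rpow_add (by norm_num)]
        refine Real.rpow_le_rpow_of_exponent_le (by norm_num) ?_
        rw [normalizedExponent, hm]
        nlinarith
      _ ≤ _ := by gcongr
  · have hT := card_tensorRelations_le_two_rpow hε h0 h1 (by linarith) hD
      (hb₀ γ h0 h1 (by linarith)) (by omega) hi hm (by omega) (by omega) hkn
    rw [div_le_iff₀ hWpos]
    calc _ ≤ (2 : ℝ) ^ (-((m : ℝ) * k)) *
          (2 ^ k * 2 ^ ((D₀ : ℝ) * k + (momentExponent k γ * n + m))) := by gcongr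
      _ ≤ 2 ^ (normalizedExponent k γ lam * n + (δ * n + (D₀ + 3) * k * lg)) *
          2 ^ ((binaryEntropy γ * n - m - 1 - lg') * (k / 2)) := by
        rw [← Real.rpow_natCast 2 k, ← Real.rpow_add (by norm_num), ← Real.rpow_add (by norm_num),
          ← Real.rpow_add (by norm_num)]
        refine Real.rpow_le_rpow_of_exponent_le (by norm_num) ?_
        have hδn : 0 ≤ δ * n := by positivity
        rw [normalizedExponent, hm]
        nlinarith
      _ ≤ _ := by gcongr
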